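/- Let $(M^m,g)$ and $(N^n,h)$ be smooth Riemannian manifolds (without boundary), $M$ connected, $m=n-1$, with Levi-Civita connections $\nabla$ and $\nabla^h$, and let $\varphi:(M,g)\to(N,h)$ be a smooth isometric immersion. Let $\overline\nabla$ be the connection induced by $\nabla^h$ on the bundle $\varphi^{-1}TN$, and for vector fields $X,Y$ on $M$ and a local orthonormal frame $\{e_i\}_{i=1}^m$ of $M$ put $$B_\varphi(X,Y)=\overline\nabla_X(d\varphi(Y))-d\varphi(\nabla_XY),\qquad \tau(\varphi)=\sum_{i=1}^m B_\varphi(e_i,e_i),\qquad \|B_\varphi\|^2=\sum_{j,k=1}^m\|B_\varphi(e_j,e_k)\|^2 .$$ Let $R^h(U,V)W=\nabla^h_U\nabla^h_VW-\nabla^h_V\nabla^h_UW-\nabla^h_{[U,V]}W$ be the curvature tensor of $N$, let $\rho^h(u)=\sum_{i=1}^n R^h(u,e_i')e_i'$ ($\{e_i'\}$ an orthonormal basis of the tangent space of $N$) be its Ricci transform, and put $$\tau_2(\varphi)=-\sum_{i=1}^m\bigl(\overline\nabla_{e_i}\overline\nabla_{e_i}\tau(\varphi)-\overline\nabla_{\nabla_{e_i}e_i}\tau(\varphi)\bigr)-\sum_{i=1}^m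 R^h(\tau(\varphi),d\varphi(e_i))\,d\varphi(e_i).$$ The map $\varphi$ is called harmonic if $\tau(\varphi)=0$ identically on $M$, and biharmonic if $\tau_2(\varphi)=0$ identically on $M$. Assume that $\tau(\varphi)$ is parallel in the normal bundle, i.e. for every vector field $X$ on $M$ the component of $\overline\nabla_X\tau(\varphi)$ normal to $d\varphi(TM)$ vanishes, and that $\varphi$ is not harmonic. Then: 1. For every unit normal vector field $\xi$ along $\varphi$, the map $\varphi$ is biharmonic if and only if $\rho^h(\xi)=\|B_\varphi\|^2\,\xi$ on $M$. 2. If $(N,h)$ is Einstein, i.e. $\rho^h=c\,\mathrm{Id}$ for a constant $c$, then $\varphi$ is biharmonic if and only if $\|B_\varphi\|^2=c$ on $M$. -/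

import Mathlib

open Bundle FiberBundle VectorField Module
open scoped Manifold ContDiff

noncomputable section

namespace RiemGeom

/-! ## The Levi-Civita connection -/

section LeviCivita

variable {E : Type*} [NormedAddCommGroup E] [NormedSpace ℝ E] [FiniteDimensional ℝ E]
  {H : Type*} [TopologicalSpace H] (I : ModelWithCorners ℝ E H)
  {M : Type*} [TopologicalSpace M] [ChartedSpace H M] [IsManifold I ∞ M]
  [RiemannianBundle (fun x : M ↦ TangentSpace I x)]

instance finiteDimensional_tangentSpace (x : M) : FiniteDimensional ℝ (TangentSpace I x) :=
  inferInstanceAs (FiniteDimensional ℝ E)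

/-- The right-hand side of the Koszul formula, i.e. the expression that determines
`g(∇_X Y, Z)` at `x`. -/
def koszul (X Y Z : Π x : M, TangentSpace I x) (x : M) : ℝ :=
  (1 / 2 : ℝ) *
    (mvfderiv I (fun y ↦ inner ℝ (Y y) (Z y)) x (X x)
      + mvfderiv I (fun y ↦ inner ℝ (X y) (Z y)) x (Y x)
      - mvfderiv I (fun y ↦ inner ℝ (X y) (Y y)) x (Z x)
      + inner ℝ (mlieBracket I X Y x) (Z x)
      - inner ℝ (mlieBracket I X Z x) (Y x)
      - inner ℝ (mlieBracket I Y Z x) (X x))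

variable [IsContMDiffRiemannianBundle I ∞ E (fun x : M ↦ TangentSpace I x)]

set_option linter.unusedSectionVars false in
theorem mdifferentiableAt_inner {X Y : Π x : M, TangentSpace I x} {x : M}
    (hX : MDiffAt (T% X) x) (hY : MDiffAt (T% Y) x) :
    MDiffAt (fun y ↦ inner ℝ (X y) (Y y)) x :=
  MDifferentiableAt.inner_bundle hX hY

theorem koszul_tensorial₁ {Y : Π x : M, TangentSpace I x} {x : M} (hY : MDiffAt (T% Y) x)
    {Z : Π x : M, TangentSpace I x} (hZ : MDiffAt (T% Z) x) :
    TensorialAt I E (fun X ↦ koszul I X Y Z x) x where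
  smul {f X} hf hX := by
    have h1 := mdifferentiableAt_inner I hX hZ
    have h2 := mdifferentiableAt_inner I hX hY
    simp [koszul, inner_smul_left, inner_smul_right, mvfderiv_fun_mul hf h1, mvfderiv_fun_mul hf h2,
      mlieBracket_smul_left hf hX, inner_add_left]
    ring
  add {X X'} hX hX' := by
    simp [koszul, inner_add_left, inner_add_right,
      mvfderiv_fun_add (mdifferentiableAt_inner I hX hZ) (mdifferentiableAt_inner I hX' hZ),
      mvfderiv_fun_add (mdifferentiableAt_inner I hX hY) (mdifferentiableAt_inner I hX' hY),
      mlieBracket_add_left hX hX']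
    ring

theorem koszul_tensorial₂ {Y : Π x : M, TangentSpace I x} {x : M} (hY : MDiffAt (T% Y) x)
    {X : Π x : M, TangentSpace I x} (hX : MDiffAt (T% X) x) :
    TensorialAt I E (fun Z ↦ koszul I X Y Z x) x where
  smul {f Z} hf hZ := by
    have h1 := mdifferentiableAt_inner I hX hZ
    have h2 := mdifferentiableAt_inner I hY hZ
    simp [koszul, inner_smul_right, mvfderiv_fun_mul hf h1, mvfderiv_fun_mul hf h2,
      mlieBracket_smul_right hf hZ, inner_add_left, inner_smul_left]
    rw [real_inner_comm (Z x) (X x), real_inner_comm (Z x) (Y x)]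
    ring
  add {Z Z'} hZ hZ' := by
    simp [koszul, inner_add_left, inner_add_right,
      mvfderiv_fun_add (mdifferentiableAt_inner I hX hZ) (mdifferentiableAt_inner I hX hZ'),
      mvfderiv_fun_add (mdifferentiableAt_inner I hY hZ) (mdifferentiableAt_inner I hY hZ'),
      mlieBracket_add_right hZ hZ']
    ring

/-- For a vector field `Y` differentiable at `x`, the bilinear form `(v, w) ↦ g(∇_v Y, w)`
on the tangent space at `x`, given by the Koszul formula. -/
def koszulForm (Y : Π x : M, TangentSpace I x) (x : M) (hY : MDiffAt (T% Y) x) :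
    TangentSpace I x →L[ℝ] TangentSpace I x →L[ℝ] ℝ :=
  TensorialAt.mkHom₂ (fun X Z ↦ koszul I X Y Z x) x
    (fun _ hZ ↦ koszul_tensorial₁ I hY hZ) (fun _ hX ↦ koszul_tensorial₂ I hY hX)

open Classical in
/-- `(∇Y)(x) : v ↦ ∇_v Y`, obtained from `koszulForm` by the Riesz isomorphism. -/
def leviCivitaAux (Y : Π x : M, TangentSpace I x) (x : M) :
    TangentSpace I x →L[ℝ] TangentSpace I x :=
  if hY : MDiffAt (T% Y) x then
    letI := FiniteDimensional.complete ℝ (TangentSpace I x)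
    (InnerProductSpace.toDual ℝ (TangentSpace I x)).symm.toContinuousLinearEquiv.toContinuousLinearMap
      ∘L koszulForm I Y x hY
  else 0

/-- The Koszul formula. -/
theorem inner_leviCivitaAux {X Y Z : Π x : M, TangentSpace I x} {x : M}
    (hX : MDiffAt (T% X) x) (hY : MDiffAt (T% Y) x) (hZ : MDiffAt (T% Z) x) :
    inner ℝ (leviCivitaAux I Y x (X x)) (Z x) = koszul I X Y Z x := by
  let _ := FiniteDimensional.complete ℝ (TangentSpace I x)
  rw [leviCivitaAux, dif_pos hY]
  have : inner ℝ ((InnerProductSpace.toDual ℝ (TangentSpace I x)).symm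
      (koszulForm I Y x hY (X x))) (Z x) = koszulForm I Y x hY (X x) (Z x) :=
    InnerProductSpace.toDual_symm_apply
  exact this.trans (TensorialAt.mkHom₂_apply _ _ hX hZ)

theorem isCovariantDerivativeOn_leviCivitaAux :
    IsCovariantDerivativeOn E (leviCivitaAux I (M := M)) where
  add {Y Y' x} hY hY' _ := by
    ext v
    refine ext_inner_right ℝ fun w ↦ ?_
    have hV := mdifferentiableAt_extend I E v
    have hW := mdifferentiableAt_extend I E w
    have h := inner_leviCivitaAux I hV (mdifferentiableAt_add_section hY hY') hW
    have h1 := inner_leviCivitaAux I hV hY hW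
    have h2 := inner_leviCivitaAux I hV hY' hW
    simp only [extend_apply_self] at h h1 h2
    rw [add_apply, inner_add_left, h1, h2, h]
    simp [koszul, inner_add_left, inner_add_right,
      mvfderiv_fun_add (mdifferentiableAt_inner I hV hY) (mdifferentiableAt_inner I hV hY'),
      mvfderiv_fun_add (mdifferentiableAt_inner I hY hW) (mdifferentiableAt_inner I hY' hW),
      mlieBracket_add_right hY hY', mlieBracket_add_left hY hY']
    ring
  leibniz {Y f x} hY hf _ := by
    ext v
    refine ext_inner_right ℝ fun w ↦ ?_
    have hV := mdifferentiableAt_extend I E v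
    have hW := mdifferentiableAt_extend I E w
    have h := inner_leviCivitaAux I hV (hf.smul_section hY) hW
    have h1 := inner_leviCivitaAux I hV hY hW
    simp only [extend_apply_self] at h h1
    rw [add_apply, inner_add_left, smul_apply,
      inner_smul_left, h1]
    refine h.trans ?_
    have e1 := mdifferentiableAt_inner I hY hW
    have e2 := mdifferentiableAt_inner I hV hY
    simp [koszul, inner_smul_left, inner_smul_right, inner_add_left,
      mvfderiv_fun_mul hf e1, mvfderiv_fun_mul hf e2, mlieBracket_smul_right hf hY,
      mlieBracket_smul_left hf hY]
    rw [real_inner_comm (Y x) v]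
    ring

/-- The Levi-Civita connection of the Riemannian manifold `M`. As always for Mathlib's covariant
derivatives, `leviCivita I Y x v` is `∇_v Y` at the point `x`. -/
def leviCivita : CovariantDerivative I E (fun x : M ↦ TangentSpace I x) where
  toFun := leviCivitaAux I
  isCovariantDerivativeOnUniv := isCovariantDerivativeOn_leviCivitaAux I

theorem leviCivita_metric {Y Z : Π x : M, TangentSpace I x} {x : M}
    (hY : MDiffAt (T% Y) x) (hZ : MDiffAt (T% Z) x) (v : TangentSpace I x) :
    mvfderiv I (fun y ↦ inner ℝ (Y y) (Z y)) x v
      = inner ℝ (leviCivita I Y x v) (Z x) + inner ℝ (Y x) (leviCivita I Z x v) := by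
  have hV := mdifferentiableAt_extend I E v
  have h1 := inner_leviCivitaAux I hV hY hZ
  have h2 := inner_leviCivitaAux I hV hZ hY
  simp only [extend_apply_self] at h1 h2
  have e : (fun y ↦ inner ℝ (Z y) (Y y)) = fun y ↦ inner ℝ (Y y) (Z y) :=
    funext fun y ↦ real_inner_comm _ _
  change _ = inner ℝ (leviCivitaAux I Y x v) (Z x) + inner ℝ (Y x) (leviCivitaAux I Z x v)
  rw [real_inner_comm (leviCivitaAux I Z x v), h1, h2, koszul, koszul, e,
    mlieBracket_swap_apply (V := Z) (W := Y), inner_neg_left, extend_apply_self]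
  ring

theorem leviCivita_torsion : (leviCivita I (M := M)).torsion = 0 := by
  rw [CovariantDerivative.torsion_eq_zero_iff]
  intro X Y x hX hY
  refine ext_inner_right ℝ fun w ↦ ?_
  have hW := mdifferentiableAt_extend I E w
  have h1 := inner_leviCivitaAux I hX hY hW
  have h2 := inner_leviCivitaAux I hY hX hW
  simp only [extend_apply_self] at h1 h2
  change inner ℝ (leviCivitaAux I Y x (X x) - leviCivitaAux I X x (Y x)) w = _
  rw [inner_sub_left, h1, h2]
  have e : (fun y ↦ inner ℝ (Y y) (X y)) = fun y ↦ inner ℝ (X y) (Y y) :=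
    funext fun y ↦ real_inner_comm _ _
  rw [koszul, koszul, e, mlieBracket_swap_apply (V := Y) (W := X), inner_neg_left,
    extend_apply_self]
  ring

end LeviCivita

/-! ## Curvature -/

section Curvature

variable {F : Type*} [NormedAddCommGroup F] [NormedSpace ℝ F] [FiniteDimensional ℝ F]
  {G : Type*} [TopologicalSpace G] (J : ModelWithCorners ℝ F G)
  {N : Type*} [TopologicalSpace N] [ChartedSpace G N] [IsManifold J ∞ N]
  [RiemannianBundle (fun y : N ↦ TangentSpace J y)]
  [IsContMDiffRiemannianBundle J ∞ F (fun y : N ↦ TangentSpace J y)]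

/-- `R(U, V)W = ∇_U ∇_V W - ∇_V ∇_U W - ∇_[U, V] W` for vector fields `U`, `V`, `W`. -/
def curvatureField (U V W : Π y : N, TangentSpace J y) (y : N) : TangentSpace J y :=
  leviCivita J (fun z ↦ leviCivita J W z (V z)) y (U y)
    - leviCivita J (fun z ↦ leviCivita J W z (U z)) y (V y)
    - leviCivita J W y (mlieBracket J U V y)

/-- The curvature tensor `R(u, v)w` for tangent vectors `u`, `v`, `w` at `y`. As
`curvatureField` is tensorial, it may be evaluated on any smooth extensions of `u`, `v`, `w`;
`extend` is the extension with constant coefficients in the preferred trivialization at `y`. -/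
def curvature (y : N) (u v w : TangentSpace J y) : TangentSpace J y :=
  curvatureField J (extend F u) (extend F v) (extend F w) y

/-- The Ricci transform `ρ(u) = ∑ i, R(u, e i) (e i)`, with `e` an orthonormal basis of the
tangent space at `y`. -/
def ricciTransform (y : N) (u : TangentSpace J y) : TangentSpace J y :=
  ∑ i, curvature J y u (stdOrthonormalBasis ℝ (TangentSpace J y) i)
    (stdOrthonormalBasis ℝ (TangentSpace J y) i)

/-- `N` is an Einstein manifold with Einstein constant `c`: its Ricci transform is `c • Id`. -/
def IsEinstein (N : Type*) [TopologicalSpace N] [ChartedSpace G N] [IsManifold J ∞ N]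
    [RiemannianBundle (fun y : N ↦ TangentSpace J y)]
    [IsContMDiffRiemannianBundle J ∞ F (fun y : N ↦ TangentSpace J y)] (c : ℝ) : Prop :=
  ∀ (y : N) (u : TangentSpace J y), ricciTransform J y u = c • u

end Curvature

/-! ## Maps between Riemannian manifolds -/

section Maps

variable {E : Type*} [NormedAddCommGroup E] [NormedSpace ℝ E] [FiniteDimensional ℝ E]
  {H : Type*} [TopologicalSpace H] (I : ModelWithCorners ℝ E H)
  {M : Type*} [TopologicalSpace M] [ChartedSpace H M] [IsManifold I ∞ M]
  [RiemannianBundle (fun x : M ↦ TangentSpace I x)]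
  [IsContMDiffRiemannianBundle I ∞ E (fun x : M ↦ TangentSpace I x)]
  {F : Type*} [NormedAddCommGroup F] [NormedSpace ℝ F] [FiniteDimensional ℝ F]
  {G : Type*} [TopologicalSpace G] (J : ModelWithCorners ℝ F G)
  {N : Type*} [TopologicalSpace N] [ChartedSpace G N] [IsManifold J ∞ N]
  [RiemannianBundle (fun y : N ↦ TangentSpace J y)]
  [IsContMDiffRiemannianBundle J ∞ F (fun y : N ↦ TangentSpace J y)]
  (φ : M → N)

/-- `φ` is an isometric immersion: it is smooth and its differential preserves inner products
(so that the differential is injective at every point). -/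
structure IsIsometricImmersion : Prop where
  contMDiff : ContMDiff I J ∞ φ
  inner_mfderiv (x : M) (u v : TangentSpace I x) :
    inner ℝ (mfderiv I J φ x u) (mfderiv I J φ x v) = inner ℝ u v

/-- The connection induced on `φ⁻¹TN` by the Levi-Civita connection of `N`; for a section `V`
of `φ⁻¹TN` (a vector field along `φ`), `pullbackCov I J φ V x v` is `∇̄_v V` at `x`.

Let `(E_k)` be the local frame of `TN` given by the preferred trivialization at `φ x`
and write `V = ∑ k, V^k • (E_k ∘ φ)` near `x`. Then
`∇̄_v V = ∑ k, (v V^k) • E_k (φ x) + ∑ k, V^k(x) • ∇_{dφ v} E_k`.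
In the first sum, `(V^k)` is the fibre coordinate of `V` in the trivialization;
the second sum is `∇_{dφ v}` of the field `∑ k, V^k(x) • E_k`, which is `extend F (V x)`. -/
def pullbackCov (V : Π x : M, TangentSpace J (φ x)) (x : M) :
    TangentSpace I x →L[ℝ] TangentSpace J (φ x) :=
  letI t := trivializationAt F (fun y : N ↦ TangentSpace J y) (φ x)
  t.symmL ℝ (φ x) ∘L mvfderiv I (fun x' ↦ (t ⟨φ x', V x'⟩).2) x
    + leviCivita J (extend F (V x)) (φ x) ∘L mfderiv I J φ x

/-- The second fundamental form `B(X, Y) = ∇̄_X (dφ Y) - dφ (∇_X Y)` for vector fields on `M`. -/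
def secondFundamentalFormField (X Y : Π x : M, TangentSpace I x) (x : M) :
    TangentSpace J (φ x) :=
  pullbackCov I J φ (fun x' ↦ mfderiv I J φ x' (Y x')) x (X x)
    - mfderiv I J φ x (leviCivita I Y x (X x))

/-- The second fundamental form on tangent vectors at `x`, by tensoriality evaluated on the
extensions of the vectors with constant coefficients in the preferred trivialization. -/
def secondFundamentalForm (x : M) (u v : TangentSpace I x) : TangentSpace J (φ x) :=
  secondFundamentalFormField I J φ (extend E u) (extend E v) x

/-- `‖B‖² = ∑ j k, ‖B(e j, e k)‖²` at `x`, with `e` an orthonormal basis of the tangent space. -/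
def secondFundamentalFormNormSq (x : M) : ℝ :=
  ∑ j, ∑ k, ‖secondFundamentalForm I J φ x (stdOrthonormalBasis ℝ (TangentSpace I x) j)
    (stdOrthonormalBasis ℝ (TangentSpace I x) k)‖ ^ 2

/-- The tension field `τ(φ) = ∑ i, B(e i, e i)`. -/
def tension (x : M) : TangentSpace J (φ x) :=
  ∑ i, secondFundamentalForm I J φ x (stdOrthonormalBasis ℝ (TangentSpace I x) i)
    (stdOrthonormalBasis ℝ (TangentSpace I x) i)

/-- `∇̄_X ∇̄_Y V - ∇̄_{∇_X Y} V` for a section `V` of `φ⁻¹TN` and vector fields `X`, `Y` on `M`;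
it is tensorial in `X` and `Y`. -/
def secondCov (V : Π x : M, TangentSpace J (φ x)) (X Y : Π x : M, TangentSpace I x) (x : M) :
    TangentSpace J (φ x) :=
  pullbackCov I J φ (fun x' ↦ pullbackCov I J φ V x' (Y x')) x (X x)
    - pullbackCov I J φ V x (leviCivita I Y x (X x))

/-- The rough Laplacian `Δ̄V = - ∑ i, (∇̄_{e i} ∇̄_{e i} V - ∇̄_{∇_{e i} e i} V)`. -/
def roughLaplacian (V : Π x : M, TangentSpace J (φ x)) (x : M) : TangentSpace J (φ x) :=
  -∑ i, secondCov I J φ V (extend E (stdOrthonormalBasis ℝ (TangentSpace I x) i))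
    (extend E (stdOrthonormalBasis ℝ (TangentSpace I x) i)) x

/-- `ℛ(V) = ∑ i, R(V, dφ (e i)) (dφ (e i))`, with `R` the curvature tensor of `N`. -/
def curvatureTrace (V : Π x : M, TangentSpace J (φ x)) (x : M) : TangentSpace J (φ x) :=
  ∑ i, curvature J (φ x) (V x) (mfderiv I J φ x (stdOrthonormalBasis ℝ (TangentSpace I x) i))
    (mfderiv I J φ x (stdOrthonormalBasis ℝ (TangentSpace I x) i))

/-- The bitension field `τ₂(φ) = Δ̄(τ(φ)) - ℛ(τ(φ))`. -/
def bitension (x : M) : TangentSpace J (φ x) :=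
  roughLaplacian I J φ (tension I J φ) x - curvatureTrace I J φ (tension I J φ) x

/-- `φ` is harmonic: its tension field vanishes identically. -/
def IsHarmonic : Prop := ∀ x, tension I J φ x = 0

/-- `φ` is biharmonic: its bitension field vanishes identically. -/
def IsBiharmonic : Prop := ∀ x, bitension I J φ x = 0

/-- The normal space of `φ` at `x`: the orthogonal complement of `dφ(T_x M)`. -/
def normalSpace (x : M) : Submodule ℝ (TangentSpace J (φ x)) :=
  (LinearMap.range (mfderiv I J φ x).toLinearMap)ᗮ

/-- The connection of the normal bundle: for a normal field `V` along `φ`, the normal component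
of `∇̄_v V`. -/
def normalCov (V : Π x : M, TangentSpace J (φ x)) (x : M) (v : TangentSpace I x) :
    TangentSpace J (φ x) :=
  (normalSpace I J φ x).starProjection (pullbackCov I J φ V x v)

/-- `ξ` is a field of unit normal vectors along `φ`. No regularity is imposed: the statements
about such fields hold in particular for the smooth ones. -/
def IsUnitNormal (ξ : Π x : M, TangentSpace J (φ x)) : Prop :=
  ∀ x, ξ x ∈ normalSpace I J φ x ∧ ‖ξ x‖ = 1

end Maps

end RiemGeom

end

/-!
Write `τ` for the tension field, `B` for the second fundamental form, `∇̄` for the induced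
connection and `S(X, Y) = ∇̄_X ∇̄_Y τ - ∇̄_{∇_X Y} τ`. The proof computes the tangential and the
normal part of the bitension field separately.

As `B` takes values in the normal bundle (`inner_secondFundamentalForm_mfderiv`), `τ` is normal,
and by hypothesis `∇̄_X τ` is tangential. Hence `⟨∇̄_X τ, τ⟩ = 0`, so `‖τ‖²` is locally constant,
and as `M` is connected and `φ` is not harmonic, `τ` vanishes nowhere (`tension_ne_zero`).
Moreover `⟨∇̄_Y τ, dφ Z⟩ = -⟨τ, B(Y, Z)⟩` (`inner_pullbackCov_mfderiv`).

*The component along `τ`.* Differentiating `⟨∇̄_X τ, τ⟩ = 0` gives `⟨S(X, X), τ⟩ = -‖∇̄_X τ‖²`,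
whose trace is `-∑ ⟨τ, B(e i, e j)⟩²`. In codimension one this is `-‖τ‖² ‖B‖²`.

*The tangential part.* Differentiating the symmetry of `⟨∇̄_Y τ, dφ Z⟩` in `Y` and `Z` gives
`⟨S(X, Y), dφ Z⟩ = ⟨S(X, Z), dφ Y⟩` (`inner_secondCov_mfderiv_symm`). The trace of the bilinear form
`⟨∇̄_Y τ, dφ Z⟩` is `-‖τ‖²`, which is locally constant, so `∑ ⟨S(Z, e i), dφ (e i)⟩ = 0`
(`sum_inner_secondCov_tension`). Finally `S(X, Y) - S(Y, X) = R(dφ X, dφ Y)τ`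
(`secondCov_sub_secondCov`). Together with the pair symmetry of `R`, these give
`⟨∑ S(e i, e i), dφ Z⟩ = ⟨∑ R(τ, dφ (e i)) dφ (e i), dφ Z⟩`
(`inner_sum_secondCov_tension_mfderiv`).

In codimension one, `∑ R(τ, dφ (e i)) dφ (e i)` is `ρ(τ)`, since the `dφ (e i)` and the unit normal
`ν` form an orthonormal basis and `R(ν, ν)ν = 0`. So the bitension field has tangential part
`-2 ρ(τ)ᵀ` and its product with `τ` is `‖τ‖² ‖B‖² - ⟨ρ(τ), τ⟩`; it vanishes if and only if
`ρ(τ) = ‖B‖² τ`, equivalently `ρ(ν) = ‖B‖² ν` (`bitension_eq_zero_iff`).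

Underneath lies the calculus of the induced connection: the Leibniz rule, compatibility with the
metric, torsion-freeness, and the fact that its curvature is the pullback of the curvature of `N`
(`pullbackCurvature_eq_curvature`). The compatibility of the connection with the metric and the
formula for `∇̄_v (∇_V W)`, with `V` a field along `φ` and `W` a field on `N`, are local and
compatible with sums and with products with functions, so it suffices to check them on fields along
`φ` that come from `N` (`SmoothAlong.induction`).
-/

open Filter Topology

noncomputable section

namespace RiemGeom

set_option linter.unusedSectionVars false

/-! ### Smooth functions, vector fields and orthonormal frames -/

section SmoothNear

variable {E : Type*} [NormedAddCommGroup E] [NormedSpace ℝ E]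
  {H : Type*} [TopologicalSpace H] {I : ModelWithCorners ℝ E H}
  {M : Type*} [TopologicalSpace M] [ChartedSpace H M]
  {F : Type*} [NormedAddCommGroup F] [NormedSpace ℝ F]
  {G : Type*} [TopologicalSpace G] {J : ModelWithCorners ℝ F G}
  {N : Type*} [TopologicalSpace N] [ChartedSpace G N]

variable (I J) in
/-- `f` is smooth at all points near `x`. This is stronger than `ContMDiffAt I J ∞ f x`, which
gives for each finite order a neighbourhood of its own. -/
def SmoothNear (f : M → N) (x : M) : Prop := ∀ᶠ y in 𝓝 x, ContMDiffAt I J ∞ f y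

namespace SmoothNear

variable {f g : M → N} {x : M}

theorem eventually (hf : SmoothNear I J f x) : ∀ᶠ y in 𝓝 x, SmoothNear I J f y :=
  eventually_eventually_nhds.2 hf

theorem contMDiffAt (hf : SmoothNear I J f x) : ContMDiffAt I J ∞ f x := hf.self_of_nhds

theorem mdifferentiableAt (hf : SmoothNear I J f x) : MDifferentiableAt I J f x :=
  hf.contMDiffAt.mdifferentiableAt (by simp)

theorem congr (hf : SmoothNear I J f x) (h : g =ᶠ[𝓝 x] f) : SmoothNear I J g x := by
  filter_upwards [hf, h.eventuallyEq_nhds] with y h1 h2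
  exact h1.congr_of_eventuallyEq h2

theorem comp_contMDiff {E' : Type*} [NormedAddCommGroup E'] [NormedSpace ℝ E']
    {H' : Type*} [TopologicalSpace H'] {I' : ModelWithCorners ℝ E' H'}
    {M' : Type*} [TopologicalSpace M'] [ChartedSpace H' M'] {φ : M' → M} {x : M'}
    (hf : SmoothNear I J f (φ x)) (hφ : ContMDiff I' I ∞ φ) :
    SmoothNear I' J (fun z ↦ f (φ z)) x := by
  filter_upwards [hφ.continuous.continuousAt.eventually hf] with y hy
  exact hy.comp y (hφ y)

theorem of_contMDiff (hf : ContMDiff I J ∞ f) : SmoothNear I J f x :=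
  .of_forall fun y ↦ hf y

theorem const (c : N) : SmoothNear I J (fun _ : M ↦ c) x := of_contMDiff contMDiff_const

end SmoothNear

theorem mvfderiv_congr {f g : M → F} {x : M} (h : f =ᶠ[𝓝 x] g) :
    mvfderiv I f x = mvfderiv I g x := by
  rw [mvfderiv, mvfderiv, h.mfderiv_eq, h.eq_of_nhds]

variable {f g : M → ℝ} {x : M}

theorem SmoothNear.add (hf : SmoothNear I 𝓘(ℝ) f x) (hg : SmoothNear I 𝓘(ℝ) g x) :
    SmoothNear I 𝓘(ℝ) (fun y ↦ f y + g y) x := by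
  filter_upwards [hf, hg] with y h1 h2 using h1.add h2

theorem SmoothNear.sub (hf : SmoothNear I 𝓘(ℝ) f x) (hg : SmoothNear I 𝓘(ℝ) g x) :
    SmoothNear I 𝓘(ℝ) (fun y ↦ f y - g y) x := by
  filter_upwards [hf, hg] with y h1 h2 using h1.sub h2

theorem SmoothNear.mul (hf : SmoothNear I 𝓘(ℝ) f x) (hg : SmoothNear I 𝓘(ℝ) g x) :
    SmoothNear I 𝓘(ℝ) (fun y ↦ f y * g y) x := by
  filter_upwards [hf, hg] with y h1 h2 using h1.mul h2

theorem mvfderiv_fun_sum_apply {ι : Type*} {s : Finset ι} {f : ι → M → ℝ} {x : M}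
    (hf : ∀ i ∈ s, MDifferentiableAt I 𝓘(ℝ) (f i) x) (v : TangentSpace I x) :
    mvfderiv I (fun z ↦ ∑ i ∈ s, f i z) x v = ∑ i ∈ s, mvfderiv I (f i) x v := by
  classical
  have h : MDifferentiableAt I 𝓘(ℝ) (fun z ↦ ∑ i ∈ s, f i z) x ∧
      mvfderiv I (fun z ↦ ∑ i ∈ s, f i z) x v = ∑ i ∈ s, mvfderiv I (f i) x v := by
    induction s using Finset.induction_on with
    | empty =>
      simp only [Finset.sum_empty]
      exact ⟨mdifferentiableAt_const, by rw [mvfderiv_const, zero_apply]⟩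
    | insert a s ha ih =>
      obtain ⟨h1, h2⟩ := ih fun i hi ↦ hf i (Finset.mem_insert_of_mem hi)
      have h3 := hf a (Finset.mem_insert_self a s)
      simp only [Finset.sum_insert ha]
      exact ⟨h3.add h1, by rw [mvfderiv_fun_add h3 h1, add_apply, h2]⟩
  exact h.2

end SmoothNear

section Along

variable {E : Type*} [NormedAddCommGroup E] [NormedSpace ℝ E]
  {H : Type*} [TopologicalSpace H] {I : ModelWithCorners ℝ E H}
  {M : Type*} [TopologicalSpace M] [ChartedSpace H M]
  {F : Type*} [NormedAddCommGroup F] [NormedSpace ℝ F]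
  {G : Type*} [TopologicalSpace G] {J : ModelWithCorners ℝ F G}
  {N : Type*} [TopologicalSpace N] [ChartedSpace G N] [IsManifold J ∞ N]
  {φ : M → N}

variable (I J φ) in
/-- The vector field `V` along `φ` is smooth at all points near `x`. -/
def SmoothAlong (V : Π x : M, TangentSpace J (φ x)) (x : M) : Prop :=
  SmoothNear I J.tangent (fun z ↦ TotalSpace.mk' F (φ z) (V z)) x

variable (I) in
/-- The vector field `X` is smooth at all points near `x`. -/
def SmoothField [IsManifold I ∞ M] (X : Π x : M, TangentSpace I x) (x : M) : Prop :=
  SmoothNear I I.tangent (T% X) x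

/-- The coordinates of a vector at `φ z` in the preferred trivialization at `φ x`. -/
def coordAt (x : M) (V : Π x : M, TangentSpace J (φ x)) (z : M) : F :=
  (trivializationAt F (fun y : N ↦ TangentSpace J y) (φ x) ⟨φ z, V z⟩).2

variable {V W : Π x : M, TangentSpace J (φ x)} {x : M}

theorem eventually_mem_baseSet (hφ : ContinuousAt φ x) :
    ∀ᶠ z in 𝓝 x, φ z ∈ (trivializationAt F (fun y : N ↦ TangentSpace J y) (φ x)).baseSet :=
  hφ.eventually <| (trivializationAt F (fun y : N ↦ TangentSpace J y) (φ x)).open_baseSet.mem_nhds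
    (mem_baseSet_trivializationAt' (φ x))

theorem coordAt_add {z : M}
    (hz : φ z ∈ (trivializationAt F (fun y : N ↦ TangentSpace J y) (φ x)).baseSet) :
    coordAt x (V + W) z = coordAt x V z + coordAt x W z :=
  ((trivializationAt F (fun y : N ↦ TangentSpace J y) (φ x)).linear ℝ hz).1 _ _

theorem coordAt_smul {z : M} (f : M → ℝ)
    (hz : φ z ∈ (trivializationAt F (fun y : N ↦ TangentSpace J y) (φ x)).baseSet) :
    coordAt x (f • V) z = f z • coordAt x V z :=
  ((trivializationAt F (fun y : N ↦ TangentSpace J y) (φ x)).linear ℝ hz).2 _ _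

theorem contMDiffAt_along_iff {x₀ : M} (hφ : ContMDiff I J ∞ φ)
    (hx : φ x ∈ (trivializationAt F (fun y : N ↦ TangentSpace J y) (φ x₀)).baseSet) :
    ContMDiffAt I J.tangent ∞ (fun z ↦ TotalSpace.mk' F (φ z) (V z)) x ↔
      ContMDiffAt I 𝓘(ℝ, F) ∞ (coordAt x₀ V) x := by
  have h := Trivialization.contMDiffAt_iff (n := ∞) (IM := I) (IB := J)
    (e := trivializationAt F (fun y : N ↦ TangentSpace J y) (φ x₀))
    (f := fun z ↦ TotalSpace.mk' F (φ z) (V z)) (x₀ := x)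
    ((Trivialization.mem_source _).2 hx)
  exact h.trans (and_iff_right (hφ x))

theorem smoothAlong_iff (hφ : ContMDiff I J ∞ φ) :
    SmoothAlong I J φ V x ↔ SmoothNear I 𝓘(ℝ, F) (coordAt x V) x := by
  refine eventually_congr ?_
  filter_upwards [eventually_mem_baseSet (J := J) hφ.continuous.continuousAt] with z hz
  exact contMDiffAt_along_iff hφ hz

theorem SmoothAlong.add (hφ : ContMDiff I J ∞ φ) (hV : SmoothAlong I J φ V x)
    (hW : SmoothAlong I J φ W x) : SmoothAlong I J φ (V + W) x := by
  rw [smoothAlong_iff hφ] at *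
  have : SmoothNear I 𝓘(ℝ, F) (fun z ↦ coordAt x V z + coordAt x W z) x := by
    filter_upwards [hV, hW] with y h1 h2 using h1.add h2
  refine this.congr ?_
  filter_upwards [eventually_mem_baseSet (J := J) hφ.continuous.continuousAt] with z hz
  exact coordAt_add hz

theorem SmoothAlong.smul (hφ : ContMDiff I J ∞ φ) {f : M → ℝ} (hf : SmoothNear I 𝓘(ℝ) f x)
    (hV : SmoothAlong I J φ V x) : SmoothAlong I J φ (f • V) x := by
  rw [smoothAlong_iff hφ] at *
  have : SmoothNear I 𝓘(ℝ, F) (fun z ↦ f z • coordAt x V z) x := by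
    filter_upwards [hf, hV] with y h1 h2 using h1.smul h2
  refine this.congr ?_
  filter_upwards [eventually_mem_baseSet (J := J) hφ.continuous.continuousAt] with z hz
  exact coordAt_smul f hz

theorem SmoothAlong.congr (hV : SmoothAlong I J φ V x) (h : ∀ᶠ z in 𝓝 x, W z = V z) :
    SmoothAlong I J φ W x :=
  SmoothNear.congr hV (h.mono fun z hz ↦ by simp [hz])

theorem SmoothAlong.eventually (hV : SmoothAlong I J φ V x) :
    ∀ᶠ y in 𝓝 x, SmoothAlong I J φ V y := SmoothNear.eventually hV

theorem SmoothAlong.mdifferentiableAt (hV : SmoothAlong I J φ V x) :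
    MDifferentiableAt I J.tangent (fun z ↦ TotalSpace.mk' F (φ z) (V z)) x :=
  SmoothNear.mdifferentiableAt hV

theorem SmoothAlong.zero (hφ : ContMDiff I J ∞ φ) : SmoothAlong I J φ 0 x := by
  rw [smoothAlong_iff hφ]
  refine (SmoothNear.const (0 : F)).congr ?_
  filter_upwards [eventually_mem_baseSet (J := J) hφ.continuous.continuousAt] with z hz
  exact ((trivializationAt F (fun y : N ↦ TangentSpace J y) (φ x)).linear ℝ hz).map_zero

theorem SmoothAlong.neg (hφ : ContMDiff I J ∞ φ) (hV : SmoothAlong I J φ V x) :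
    SmoothAlong I J φ (-V) x := by
  have h := SmoothAlong.smul hφ (SmoothNear.const (-1 : ℝ)) hV
  exact h.congr (.of_forall fun z ↦ (neg_one_smul ℝ (V z)).symm)

theorem SmoothAlong.sub (hφ : ContMDiff I J ∞ φ) (hV : SmoothAlong I J φ V x)
    (hW : SmoothAlong I J φ W x) : SmoothAlong I J φ (V - W) x := by
  rw [sub_eq_add_neg]
  exact hV.add hφ (hW.neg hφ)

theorem SmoothAlong.sum (hφ : ContMDiff I J ∞ φ) {ι : Type*} {s : Finset ι}
    {V : ι → Π x : M, TangentSpace J (φ x)} (hV : ∀ i ∈ s, SmoothAlong I J φ (V i) x) :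
    SmoothAlong I J φ (∑ i ∈ s, V i) x := by
  classical
  induction s using Finset.induction_on with
  | empty => simpa using SmoothAlong.zero hφ
  | insert a s ha ih =>
    rw [Finset.sum_insert ha]
    exact (hV a (Finset.mem_insert_self a s)).add hφ
      (ih fun i hi ↦ hV i (Finset.mem_insert_of_mem hi))

/-- The restriction to `M` of a smooth vector field on `N`. -/
theorem SmoothField.along (hφ : ContMDiff I J ∞ φ) {W : Π y : N, TangentSpace J y}
    (hW : SmoothField J W (φ x)) : SmoothAlong I J φ (fun z ↦ W (φ z)) x :=
  SmoothNear.comp_contMDiff hW hφ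

theorem extend_apply_of_mem {y z : N} (v : TangentSpace J y)
    (hz : z ∈ (trivializationAt F (fun y : N ↦ TangentSpace J y) y).baseSet) :
    extend F v z = (trivializationAt F (fun y : N ↦ TangentSpace J y) y).symmₗ ℝ z
      ((trivializationAt F (fun y : N ↦ TangentSpace J y) y).linearMapAt ℝ y v) := by
  rw [Trivialization.symmₗ_apply _ hz,
    Trivialization.linearMapAt_apply, if_pos (mem_baseSet_trivializationAt' y)]
  rfl

theorem eventually_mem_baseSet_self (y : N) :
    ∀ᶠ z in 𝓝 y, z ∈ (trivializationAt F (fun y : N ↦ TangentSpace J y) y).baseSet :=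
  eventually_mem_baseSet (φ := fun z ↦ z) continuousAt_id

theorem extend_add (y : N) (u v : TangentSpace J y) :
    ∀ᶠ z in 𝓝 y, extend F (u + v) z = extend F u z + extend F v z := by
  filter_upwards [eventually_mem_baseSet_self (J := J) y] with z hz
  simp only [extend_apply_of_mem _ hz, map_add]

theorem extend_smul (y : N) (c : ℝ) (v : TangentSpace J y) :
    ∀ᶠ z in 𝓝 y, extend F (c • v) z = c • extend F v z := by
  filter_upwards [eventually_mem_baseSet_self (J := J) y] with z hz
  simp only [extend_apply_of_mem _ hz, map_smul]

theorem smoothField_extend [FiniteDimensional ℝ F] {y : N} (v : TangentSpace J y) :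
    SmoothField J (extend F v) y := by
  obtain ⟨s, hs, h⟩ := exists_contMDiffOn_extend (k := ∞) J F v
  filter_upwards [eventually_mem_nhds_iff.2 hs] with z hz
  exact h.contMDiffAt hz

/-- A property of smooth vector fields along `φ` near `x` which is local, and stable under sums and
products with smooth functions, holds for all of them as soon as it holds for the restrictions of
the fields with constant coefficients in the preferred trivialization at `φ x`: these
generate all the others. -/
theorem SmoothAlong.induction [FiniteDimensional ℝ F] (hφ : ContMDiff I J ∞ φ) {x : M}
    {P : (Π x : M, TangentSpace J (φ x)) → Prop}
    (congr : ∀ {V W : Π x : M, TangentSpace J (φ x)}, SmoothAlong I J φ V x →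
      (∀ᶠ z in 𝓝 x, W z = V z) → P V → P W)
    (add : ∀ {V W : Π x : M, TangentSpace J (φ x)}, SmoothAlong I J φ V x →
      SmoothAlong I J φ W x → P V → P W → P (V + W))
    (smul : ∀ {f : M → ℝ} {V : Π x : M, TangentSpace J (φ x)}, SmoothNear I 𝓘(ℝ) f x →
      SmoothAlong I J φ V x → P V → P (f • V))
    (base : ∀ w : TangentSpace J (φ x), P (fun z ↦ extend F w (φ z)))
    {V : Π x : M, TangentSpace J (φ x)} (hV : SmoothAlong I J φ V x) : P V := by
  classical
  let t := trivializationAt F (fun y : N ↦ TangentSpace J y) (φ x)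
  let b := Module.finBasis ℝ F
  let e (l) : TangentSpace J (φ x) := t.symmₗ ℝ (φ x) (b l)
  let c (l) (z : M) : ℝ := b.repr (coordAt x V z) l
  have hbase (l) : SmoothAlong I J φ (fun z ↦ extend F (e l) (φ z)) x :=
    (smoothField_extend (e l)).along hφ
  have hc (l) : SmoothNear I 𝓘(ℝ) (c l) x := by
    filter_upwards [(smoothAlong_iff hφ).1 hV] with z hz
    exact (LinearMap.toContinuousLinearMap (b.coord l)).contMDiff.contMDiffAt.comp z hz
  have hsum : ∀ s : Finset (Fin (finrank ℝ F)),
      SmoothAlong I J φ (∑ l ∈ s, c l • fun z ↦ extend F (e l) (φ z)) x ∧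
        P (∑ l ∈ s, c l • fun z ↦ extend F (e l) (φ z)) := by
    intro s
    induction s using Finset.induction_on with
    | empty =>
      refine ⟨by simpa using SmoothAlong.zero hφ, ?_⟩
      have h := smul (SmoothNear.const (0 : ℝ)) ((smoothField_extend 0).along hφ) (base 0)
      refine congr (SmoothAlong.smul hφ (SmoothNear.const (0 : ℝ))
        ((smoothField_extend 0).along hφ)) (.of_forall fun z ↦ ?_) h
      exact (zero_smul ℝ (extend F (0 : TangentSpace J (φ x)) (φ z))).symm
    | insert a s ha ih =>
      rw [Finset.sum_insert ha]
      have ha' := (hbase a).smul hφ (hc a)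
      exact ⟨ha'.add hφ ih.1, add ha' ih.1 (smul (hc a) (hbase a) (base (e a))) ih.2⟩
  refine congr (hsum Finset.univ).1 ?_ (hsum Finset.univ).2
  filter_upwards [eventually_mem_baseSet (J := J) hφ.continuous.continuousAt] with z hz
  have h1 : V z = t.symmₗ ℝ (φ z) (coordAt x V z) := by
    have : coordAt x V z = t.linearMapAt ℝ (φ z) (V z) := by
      rw [Trivialization.linearMapAt_apply, if_pos hz]; rfl
    rw [this, Trivialization.symmₗ_linearMapAt _ hz]
  rw [h1, ← b.sum_repr (coordAt x V z), map_sum, Finset.sum_apply]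
  refine Finset.sum_congr rfl fun l _ ↦ ?_
  have h2 : t.linearMapAt ℝ (φ x) (e l) = b l :=
    Trivialization.linearMapAt_symmₗ _ (mem_baseSet_trivializationAt' (φ x)) _
  rw [map_smul, Pi.smul_apply', extend_apply_of_mem _ hz, h2]

/-- The differential of a smooth map sends smooth fields to smooth fields along the map. -/
theorem SmoothField.mfderiv_along [IsManifold I ∞ M] (hφ : ContMDiff I J ∞ φ)
    {X : Π x : M, TangentSpace I x} (hX : SmoothField I X x) :
    SmoothAlong I J φ (fun z ↦ mfderiv I J φ z (X z)) x := by
  filter_upwards [hX] with z hz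
  exact (hφ.contMDiff_tangentMap (m := ∞) (by simp)).contMDiffAt.comp z hz

/-- The derivative of a smooth function along a smooth field is smooth. -/
theorem SmoothNear.mvfderiv_apply [IsManifold I ∞ M] {f : M → ℝ} (hf : SmoothNear I 𝓘(ℝ) f x)
    {X : Π x : M, TangentSpace I x} (hX : SmoothField I X x) :
    SmoothNear I 𝓘(ℝ) (fun z ↦ mvfderiv I f z (X z)) x := by
  obtain ⟨U, hU, hUo, hxU⟩ := mem_nhds_iff.1 hf
  have hfU : ContMDiffOn I 𝓘(ℝ) ∞ f U := fun z hz ↦ (hU hz).contMDiffWithinAt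
  have ht := hfU.contMDiffOn_tangentMapWithin (m := ∞) (by simp) hUo.uniqueMDiffOn
  filter_upwards [hX, hUo.mem_nhds hxU] with z hz hzU
  have h1 : ContMDiffAt I 𝓘(ℝ).tangent ∞ (fun y ↦ tangentMapWithin I 𝓘(ℝ) f U ⟨y, X y⟩) z := by
    refine (ht.contMDiffAt ?_).comp z hz
    exact (hUo.preimage (FiberBundle.continuous_proj E (TangentSpace I))).mem_nhds hzU
  have h2 := (contMDiff_snd_tangentBundle_modelSpace ℝ 𝓘(ℝ) (n := ∞)).contMDiffAt.comp z h1
  refine h2.congr_of_eventuallyEq ?_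
  filter_upwards [hUo.mem_nhds hzU] with y hy
  have h3 : mfderivWithin I 𝓘(ℝ) f U y = mfderiv I 𝓘(ℝ) f y := mfderivWithin_of_isOpen hUo hy
  change mfderiv I 𝓘(ℝ) f y (X y) = mfderivWithin I 𝓘(ℝ) f U y (X y)
  rw [h3]

end Along

section Frame

variable {E : Type*} [NormedAddCommGroup E] [NormedSpace ℝ E] [FiniteDimensional ℝ E]
  {H : Type*} [TopologicalSpace H] {I : ModelWithCorners ℝ E H}
  {M : Type*} [TopologicalSpace M] [ChartedSpace H M] [IsManifold I ∞ M]
  [RiemannianBundle (fun x : M ↦ TangentSpace I x)]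
  [IsContMDiffRiemannianBundle I ∞ E (fun x : M ↦ TangentSpace I x)]

variable {X Y : Π x : M, TangentSpace I x} {x : M}

theorem SmoothField.inner (hX : SmoothField I X x) (hY : SmoothField I Y x) :
    SmoothNear I 𝓘(ℝ) (fun z ↦ inner ℝ (X z) (Y z)) x := by
  filter_upwards [hX, hY] with z h1 h2
  exact ContMDiffAt.inner_bundle h1 h2

/-- An orthonormal family at `x` extends to a smooth family of fields, orthonormal
near `x`: apply the Gram-Schmidt process to arbitrary smooth extensions. -/
theorem exists_orthonormal_extension {k : ℕ} {v : Fin k → TangentSpace I x}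
    (hv : Orthonormal ℝ v) :
    ∃ f : Fin k → Π z : M, TangentSpace I z, (∀ i, SmoothField I (f i) x) ∧
      (∀ i, f i x = v i) ∧ ∀ᶠ z in 𝓝 x, Orthonormal ℝ (fun i ↦ f i z) := by
  have hid : ContMDiff I I ∞ (fun z : M ↦ z) := contMDiff_id
  let g (i : Fin k) (z : M) : TangentSpace I z :=
    InnerProductSpace.gramSchmidt ℝ (fun j ↦ extend E (v j) z) i
  have hg (i) (z) : g i z = extend E (v i) z - ∑ j ∈ Finset.Iio i,
      (inner ℝ (g j z) (extend E (v i) z) / inner ℝ (g j z) (g j z)) • g j z := by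
    have h := InnerProductSpace.gramSchmidt_def'' ℝ (fun j ↦ extend E (v j) z) i
    simp only [← real_inner_self_eq_norm_sq, RCLike.ofReal_real_eq_id, id] at h
    exact eq_sub_of_add_eq h.symm
  have hmain (i) : SmoothField I (g i) x ∧ g i x = v i := by
    induction i using WellFoundedLT.induction with
    | ind i ih =>
    constructor
    · have h1 (j) (hj : j ∈ Finset.Iio i) : SmoothField I
          ((fun z ↦ inner ℝ (g j z) (extend E (v i) z) / inner ℝ (g j z) (g j z)) • g j) x := by
        obtain ⟨h2, h3⟩ := ih j (Finset.mem_Iio.1 hj)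
        refine SmoothAlong.smul hid ?_ h2
        have h4 := h2.inner (smoothField_extend (v i))
        have h5 := h2.inner h2
        have h6 : (inner ℝ (g j x) (g j x) : ℝ) ≠ 0 := by
          rw [h3, real_inner_self_eq_norm_sq, hv.1 j]; norm_num
        filter_upwards [h4, h5, h5.contMDiffAt.continuousAt.eventually_ne h6] with z h7 h8 h9
        exact h7.div₀ h8 h9
      have h2 := SmoothAlong.sub hid (smoothField_extend (v i)) (SmoothAlong.sum hid h1)
      refine SmoothAlong.congr h2 (.of_forall fun z ↦ ?_)
      simp only [Pi.sub_apply, Finset.sum_apply, Pi.smul_apply']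
      exact hg i z
    · rw [hg, Finset.sum_eq_zero, sub_zero, extend_apply_self]
      intro j hj
      have hj := Finset.mem_Iio.1 hj
      rw [(ih j hj).2, extend_apply_self, hv.2 hj.ne, zero_div, zero_smul]
  have hpos (i) : ∀ᶠ z in 𝓝 x, (inner ℝ (g i z) (g i z) : ℝ) ≠ 0 := by
    refine ((hmain i).1.inner (hmain i).1).contMDiffAt.continuousAt.eventually_ne ?_
    rw [(hmain i).2, real_inner_self_eq_norm_sq, hv.1 i]; norm_num
  refine ⟨fun i z ↦ (Real.sqrt (inner ℝ (g i z) (g i z)))⁻¹ • g i z, fun i ↦ ?_, fun i ↦ ?_, ?_⟩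
  · refine SmoothAlong.smul (f := fun z ↦ (Real.sqrt (inner ℝ (g i z) (g i z)))⁻¹) hid ?_
      (hmain i).1
    filter_upwards [(hmain i).1.inner (hmain i).1, hpos i] with z h1 h2
    have h3 : ContDiffAt ℝ ∞ (fun t : ℝ ↦ (Real.sqrt t)⁻¹) (inner ℝ (g i z) (g i z)) :=
      (Real.contDiffAt_sqrt h2).inv (by
        rw [Real.sqrt_ne_zero']
        exact lt_of_le_of_ne real_inner_self_nonneg h2.symm)
    exact ContMDiffAt.comp (f := fun z ↦ (inner ℝ (g i z) (g i z) : ℝ)) z h3.contMDiffAt h1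
  · simp only [(hmain i).2, real_inner_self_eq_norm_sq, hv.1 i]
    simp
  · filter_upwards [Filter.eventually_all.2 hpos] with z hz
    constructor
    · intro i
      have h1 : g i z ≠ 0 := fun h ↦ hz i (by rw [h, inner_zero_left])
      simp only [real_inner_self_eq_norm_sq]
      rw [Real.sqrt_sq (norm_nonneg _), norm_smul, norm_inv, norm_norm,
        inv_mul_cancel₀ (norm_ne_zero_iff.2 h1)]
    · intro i j hij
      simp only [inner_smul_left, inner_smul_right]
      rw [InnerProductSpace.gramSchmidt_orthogonal ℝ _ hij]
      simp

/-- A smooth local orthonormal frame with prescribed value at `x`. -/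
theorem exists_orthonormalFrame {k : ℕ} (e : OrthonormalBasis (Fin k) ℝ (TangentSpace I x)) :
    ∃ f : Fin k → Π z : M, TangentSpace I z, (∀ i, SmoothField I (f i) x) ∧
      (∀ i, f i x = e i) ∧
      ∀ᶠ z in 𝓝 x, ∃ b : OrthonormalBasis (Fin k) ℝ (TangentSpace I z), ∀ i, b i = f i z := by
  obtain ⟨f, h1, h2, h3⟩ := exists_orthonormal_extension e.orthonormal
  refine ⟨f, h1, h2, h3.mono fun z hz ↦ ?_⟩
  have hk : Fintype.card (Fin k) = finrank ℝ (TangentSpace I z) := by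
    have h4 := finrank_eq_card_basis e.toBasis
    rw [← h4]; rfl
  refine ⟨OrthonormalBasis.mk hz ?_, fun i ↦ congrFun (OrthonormalBasis.coe_mk hz _) i⟩
  exact (hz.linearIndependent.span_eq_top_of_card_eq_finrank' hk).ge

/-- A field whose inner products with all smooth fields are smooth is smooth. -/
theorem smoothField_of_inner
    (h : ∀ Z : Π x : M, TangentSpace I x, SmoothField I Z x →
      SmoothNear I 𝓘(ℝ) (fun z ↦ inner ℝ (Z z) (X z)) x) : SmoothField I X x := by
  have hid : ContMDiff I I ∞ (fun z : M ↦ z) := contMDiff_id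
  obtain ⟨f, h1, -, h3⟩ := exists_orthonormalFrame (stdOrthonormalBasis ℝ (TangentSpace I x))
  have h4 : SmoothField I (∑ i, (fun z ↦ inner ℝ (f i z) (X z)) • f i) x :=
    SmoothAlong.sum hid fun i _ ↦ SmoothAlong.smul hid (h _ (h1 i)) (h1 i)
  refine SmoothAlong.congr h4 (h3.mono fun z ⟨b, hb⟩ ↦ ?_)
  rw [← b.sum_repr' (X z), Finset.sum_apply]
  simp only [hb]
  rfl

end Frame

/-! ### The induced connection -/

section PullbackConnection

variable {E : Type*} [NormedAddCommGroup E] [NormedSpace ℝ E] [FiniteDimensional ℝ E]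
  {H : Type*} [TopologicalSpace H] {I : ModelWithCorners ℝ E H}
  {M : Type*} [TopologicalSpace M] [ChartedSpace H M] [IsManifold I ∞ M]
  {F : Type*} [NormedAddCommGroup F] [NormedSpace ℝ F] [FiniteDimensional ℝ F]
  {G : Type*} [TopologicalSpace G] {J : ModelWithCorners ℝ F G}
  {N : Type*} [TopologicalSpace N] [ChartedSpace G N] [IsManifold J ∞ N]
  [RiemannianBundle (fun y : N ↦ TangentSpace J y)]
  [IsContMDiffRiemannianBundle J ∞ F (fun y : N ↦ TangentSpace J y)]
  {φ : M → N}

theorem SmoothField.mdifferentiableAt {X : Π x : M, TangentSpace I x} {x : M}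
    (hX : SmoothField I X x) : MDiffAt (T% X) x :=
  SmoothNear.mdifferentiableAt hX

section LeviCivita

variable {y : N} {U V W : Π y : N, TangentSpace J y}

theorem leviCivita_congr (hV : SmoothField J V y) (h : ∀ᶠ z in 𝓝 y, W z = V z) :
    leviCivita J W y = leviCivita J V y :=
  (leviCivita J).isCovariantDerivativeOnUniv.congr_of_eventuallyEq
    (SmoothAlong.congr (φ := fun z ↦ z) hV h).mdifferentiableAt hV.mdifferentiableAt
    Filter.univ_mem h

theorem leviCivita_add (hV : SmoothField J V y) (hW : SmoothField J W y) :
    leviCivita J (V + W) y = leviCivita J V y + leviCivita J W y :=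
  (leviCivita J).isCovariantDerivativeOnUniv.add hV.mdifferentiableAt hW.mdifferentiableAt

theorem leviCivita_extend_add (u v : TangentSpace J y) :
    leviCivita J (extend F (u + v)) y
      = leviCivita J (extend F u) y + leviCivita J (extend F v) y := by
  rw [← leviCivita_add (smoothField_extend u) (smoothField_extend v)]
  exact leviCivita_congr (SmoothAlong.add (φ := fun z ↦ z) contMDiff_id
    (smoothField_extend u) (smoothField_extend v)) (extend_add y u v)

theorem leviCivita_extend_smul (c : ℝ) (v : TangentSpace J y) :
    leviCivita J (extend F (c • v)) y = c • leviCivita J (extend F v) y := by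
  rw [← (leviCivita J).isCovariantDerivativeOnUniv.smul_const c
    (smoothField_extend v).mdifferentiableAt]
  exact leviCivita_congr (SmoothAlong.smul (φ := fun z ↦ z) contMDiff_id
    (SmoothNear.const c) (smoothField_extend v)) (extend_smul y c v)

end LeviCivita

variable {V W : Π x : M, TangentSpace J (φ x)} {x : M}

theorem pullbackCov_apply (v : TangentSpace I x) :
    pullbackCov I J φ V x v
      = (trivializationAt F (fun y : N ↦ TangentSpace J y) (φ x)).symmL ℝ (φ x)
          (mvfderiv I (coordAt x V) x v)
        + leviCivita J (extend F (V x)) (φ x) (mfderiv I J φ x v) := rfl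

theorem pullbackCov_congr (h : ∀ᶠ z in 𝓝 x, W z = V z) :
    pullbackCov I J φ W x = pullbackCov I J φ V x := by
  have h1 : coordAt x W =ᶠ[𝓝 x] coordAt x V := h.mono fun z hz ↦ by simp only [coordAt, hz]
  ext v
  rw [pullbackCov_apply, pullbackCov_apply, h.self_of_nhds, mvfderiv_congr h1]

theorem pullbackCov_add (hφ : ContMDiff I J ∞ φ) (hV : SmoothAlong I J φ V x)
    (hW : SmoothAlong I J φ W x) :
    pullbackCov I J φ (V + W) x = pullbackCov I J φ V x + pullbackCov I J φ W x := by
  have h1 : coordAt x (V + W) =ᶠ[𝓝 x] fun z ↦ coordAt x V z + coordAt x W z :=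
    (eventually_mem_baseSet hφ.continuous.continuousAt).mono fun z hz ↦ coordAt_add hz
  have h2 : mvfderiv I (coordAt x (V + W)) x
      = mvfderiv I (coordAt x V) x + mvfderiv I (coordAt x W) x := by
    rw [← mvfderiv_fun_add ((smoothAlong_iff hφ).1 hV).mdifferentiableAt
      ((smoothAlong_iff hφ).1 hW).mdifferentiableAt, mvfderiv_congr h1]
  ext v
  rw [add_apply, pullbackCov_apply, pullbackCov_apply, pullbackCov_apply, h2, Pi.add_apply,
    leviCivita_extend_add, add_apply, add_apply, map_add]
  abel

theorem pullbackCov_smul (hφ : ContMDiff I J ∞ φ) {f : M → ℝ} (hf : SmoothNear I 𝓘(ℝ) f x)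
    (hV : SmoothAlong I J φ V x) (v : TangentSpace I x) :
    pullbackCov I J φ (f • V) x v = f x • pullbackCov I J φ V x v + mvfderiv I f x v • V x := by
  have h1 : coordAt x (f • V) =ᶠ[𝓝 x] fun z ↦ f z • coordAt x V z :=
    (eventually_mem_baseSet hφ.continuous.continuousAt).mono fun z hz ↦ coordAt_smul f hz
  have h2 : mvfderiv I (coordAt x (f • V)) x
      = f x • mvfderiv I (coordAt x V) x + (mvfderiv I f x).smulRight (coordAt x V x) := by
    rw [← mvfderiv_fun_smul hf.mdifferentiableAt
      ((smoothAlong_iff hφ).1 hV).mdifferentiableAt, mvfderiv_congr h1]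
  have hx := mem_baseSet_trivializationAt' (F := F) (E := fun y : N ↦ TangentSpace J y) (φ x)
  have h3 : (trivializationAt F (fun y : N ↦ TangentSpace J y) (φ x)).symmL ℝ (φ x)
      (coordAt x V x) = V x := by
    have h4 := Trivialization.symmL_continuousLinearMapAt (R := ℝ)
      (trivializationAt F (fun y : N ↦ TangentSpace J y) (φ x)) hx (V x)
    rwa [Trivialization.continuousLinearMapAt_apply, Trivialization.linearMapAt_apply,
      if_pos hx] at h4
  rw [pullbackCov_apply, pullbackCov_apply, h2, Pi.smul_apply', leviCivita_extend_smul,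
    add_apply, smul_apply, smul_apply, ContinuousLinearMap.smulRight_apply, map_add, map_smul,
    map_smul, h3, smul_add]
  abel

/-- On the restriction to `M` of a field on `N`, the induced connection is the Levi-Civita
connection of `N`. -/
theorem pullbackCov_comp (hφ : ContMDiff I J ∞ φ) {W : Π y : N, TangentSpace J y}
    (hW : SmoothField J W (φ x)) (v : TangentSpace I x) :
    pullbackCov I J φ (fun z ↦ W (φ z)) x v
      = leviCivita J W (φ x) (mfderiv I J φ x v) := by
  have hid : ContMDiff J J ∞ (fun y : N ↦ y) := contMDiff_id
  refine SmoothAlong.induction (φ := fun y : N ↦ y) hid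
    (P := fun W ↦ pullbackCov I J φ (fun z ↦ W (φ z)) x v
      = leviCivita J W (φ x) (mfderiv I J φ x v)) ?_ ?_ ?_ ?_ hW
  · intro V W hV h hP
    rw [leviCivita_congr hV h, ← hP]
    have h' : ∀ᶠ z in 𝓝 x, W (φ z) = V (φ z) := hφ.continuous.continuousAt.eventually h
    exact congrArg (· v) (pullbackCov_congr (I := I) (J := J) (φ := φ)
      (V := fun z ↦ V (φ z)) (W := fun z ↦ W (φ z)) h')
  · intro V W hV hW h1 h2
    rw [leviCivita_add hV hW, add_apply, ← h1, ← h2]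
    exact congrArg (· v) (pullbackCov_add hφ (SmoothField.along hφ hV) (SmoothField.along hφ hW))
  · intro f V hf hV h
    have h1 := congrArg (· (mfderiv I J φ x v))
      ((leviCivita J).isCovariantDerivativeOnUniv.leibniz
        (SmoothField.mdifferentiableAt hV) hf.mdifferentiableAt)
    refine Eq.trans ?_ h1.symm
    have h2 := mvfderiv_comp_apply x hf.mdifferentiableAt (hφ.mdifferentiable (by simp) x) v
    have h3 := pullbackCov_smul hφ (hf.comp_contMDiff hφ) (SmoothField.along hφ hV) v
    rw [h] at h3
    refine h3.trans ?_
    rw [add_apply, smul_apply, ContinuousLinearMap.smulRight_apply, ← h2]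
    rfl
  · intro w
    have h1 : coordAt x (fun z ↦ extend F w (φ z)) =ᶠ[𝓝 x] fun _ ↦
        (trivializationAt F (fun y : N ↦ TangentSpace J y) (φ x) ⟨φ x, w⟩).2 := by
      filter_upwards [eventually_mem_baseSet (J := J) hφ.continuous.continuousAt] with z hz
      simp only [coordAt, extend]
      rw [Trivialization.apply_mk_symm _ hz]
    have h2 : mvfderiv I (coordAt x fun z ↦ extend F w (φ z)) x v = 0 := by
      rw [mvfderiv_congr h1, mvfderiv_const, zero_apply]
    rw [pullbackCov_apply, h2, map_zero, zero_add]
    beta_reduce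
    rw [extend_apply_self]

theorem SmoothAlong.inner (hV : SmoothAlong I J φ V x) (hW : SmoothAlong I J φ W x) :
    SmoothNear I 𝓘(ℝ) (fun z ↦ inner ℝ (V z) (W z)) x := by
  filter_upwards [hV, hW] with z h1 h2
  exact ContMDiffAt.inner_bundle h1 h2

/-- The induced connection is compatible with the metric. -/
theorem pullbackCov_metric (hφ : ContMDiff I J ∞ φ) (hV : SmoothAlong I J φ V x)
    (hW : SmoothAlong I J φ W x) (v : TangentSpace I x) :
    mvfderiv I (fun z ↦ inner ℝ (V z) (W z)) x v
      = inner ℝ (pullbackCov I J φ V x v) (W x) + inner ℝ (V x) (pullbackCov I J φ W x v) := by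
  revert hW
  refine SmoothAlong.induction hφ (P := fun V ↦ SmoothAlong I J φ W x →
    mvfderiv I (fun z ↦ inner ℝ (V z) (W z)) x v
      = inner ℝ (pullbackCov I J φ V x v) (W x) + inner ℝ (V x) (pullbackCov I J φ W x v))
    ?_ ?_ ?_ ?_ hV
  · intro V V' hV h hP hW
    have h1 : (fun z ↦ (inner ℝ (V' z) (W z) : ℝ)) =ᶠ[𝓝 x] fun z ↦ inner ℝ (V z) (W z) :=
      h.mono fun z hz ↦ by simp only [hz]
    rw [pullbackCov_congr h, h.self_of_nhds, ← hP hW, mvfderiv_congr h1]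
  · intro V V' hV hV' h1 h2 hW
    simp only [Pi.add_apply, inner_add_left]
    rw [mvfderiv_fun_add (hV.inner hW).mdifferentiableAt (hV'.inner hW).mdifferentiableAt,
      pullbackCov_add hφ hV hV', add_apply, add_apply, h1 hW, h2 hW, inner_add_left]
    ring
  · intro f V hf hV h hW
    simp only [Pi.smul_apply', inner_smul_left]
    rw [pullbackCov_smul hφ hf hV, inner_add_left, inner_smul_left, inner_smul_left]
    simp only [RCLike.conj_to_real]
    rw [mvfderiv_fun_mul hf.mdifferentiableAt (hV.inner hW).mdifferentiableAt, add_apply,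
      smul_apply, smul_apply, h hW]
    simp only [smul_eq_mul]
    ring
  intro w hW
  refine SmoothAlong.induction hφ (P := fun W ↦
    mvfderiv I (fun z ↦ inner ℝ (extend F w (φ z)) (W z)) x v
      = inner ℝ (pullbackCov I J φ (fun z ↦ extend F w (φ z)) x v) (W x)
        + inner ℝ (extend F w (φ x)) (pullbackCov I J φ W x v))
    ?_ ?_ ?_ ?_ hW
  · intro V V' hV h hP
    have h1 : (fun z ↦ (inner ℝ (extend F w (φ z)) (V' z) : ℝ))
        =ᶠ[𝓝 x] fun z ↦ inner ℝ (extend F w (φ z)) (V z) := h.mono fun z hz ↦ by simp only [hz]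
    rw [pullbackCov_congr h, h.self_of_nhds, ← hP, mvfderiv_congr h1]
  · intro V V' hV hV' h1 h2
    have hw : SmoothAlong I J φ (fun z ↦ extend F w (φ z)) x := (smoothField_extend w).along hφ
    simp only [Pi.add_apply, inner_add_right]
    rw [mvfderiv_fun_add (hw.inner hV).mdifferentiableAt (hw.inner hV').mdifferentiableAt,
      pullbackCov_add hφ hV hV', add_apply, add_apply, h1, h2, inner_add_right]
    ring
  · intro f V hf hV h
    have hw : SmoothAlong I J φ (fun z ↦ extend F w (φ z)) x := (smoothField_extend w).along hφ
    simp only [Pi.smul_apply', inner_smul_right]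
    rw [pullbackCov_smul hφ hf hV, inner_add_right, inner_smul_right, inner_smul_right,
      mvfderiv_fun_mul hf.mdifferentiableAt (hw.inner hV).mdifferentiableAt, add_apply,
      smul_apply, smul_apply, h]
    simp only [smul_eq_mul]
    ring
  · intro u
    have hw := smoothField_extend w
    have hu := smoothField_extend u
    rw [pullbackCov_comp hφ hw, pullbackCov_comp hφ hu,
      ← leviCivita_metric J hw.mdifferentiableAt hu.mdifferentiableAt]
    exact mvfderiv_comp_apply x (hw.inner hu).mdifferentiableAt
      (hφ.mdifferentiable (by simp) x) v

theorem SmoothField.mlieBracket {X Y : Π x : M, TangentSpace I x} (hX : SmoothField I X x)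
    (hY : SmoothField I Y x) : SmoothField I (mlieBracket I X Y) x := by
  filter_upwards [hX, hY] with z h1 h2
  have : IsManifold I (minSmoothness ℝ 2) M := by
    rw [minSmoothness_of_isRCLikeNormedField]
    infer_instance
  have : IsManifold I ((⊤ : ℕ∞) + 1) M := by simpa using (inferInstance : IsManifold I ∞ M)
  exact ContMDiffAt.mlieBracket_vectorField (n := ⊤) (m := ⊤) h1 h2 (by simp)

/-- `∇_X Y` is smooth: its inner products with smooth fields are, by the Koszul formula. -/
theorem SmoothField.leviCivita {X Y : Π y : N, TangentSpace J y} {y : N}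
    (hX : SmoothField J X y) (hY : SmoothField J Y y) :
    SmoothField J (fun z ↦ leviCivita J Y z (X z)) y := by
  refine smoothField_of_inner fun Z hZ ↦ ?_
  have h1 := (hY.inner hZ).mvfderiv_apply hX
  have h2 := (hX.inner hZ).mvfderiv_apply hY
  have h3 := (hX.inner hY).mvfderiv_apply hZ
  have h4 := (hX.mlieBracket hY).inner hZ
  have h5 := (hX.mlieBracket hZ).inner hY
  have h6 := (hY.mlieBracket hZ).inner hX
  refine ((SmoothNear.const (1 / 2 : ℝ)).mul
    (((((h1.add h2).sub h3).add h4).sub h5).sub h6)).congr ?_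
  filter_upwards [SmoothNear.eventually hX, SmoothNear.eventually hY, SmoothNear.eventually hZ]
    with z hX hY hZ
  rw [real_inner_comm]
  exact inner_leviCivitaAux J (SmoothField.mdifferentiableAt hX)
    (SmoothField.mdifferentiableAt hY) (SmoothField.mdifferentiableAt hZ)

theorem SmoothAlong.leviCivita_comp (hφ : ContMDiff I J ∞ φ) (hV : SmoothAlong I J φ V x)
    {W : Π y : N, TangentSpace J y} (hW : SmoothField J W (φ x)) :
    SmoothAlong I J φ (fun z ↦ leviCivita J W (φ z) (V z)) x := by
  refine SmoothAlong.induction hφ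
    (P := fun V ↦ SmoothAlong I J φ (fun z ↦ RiemGeom.leviCivita J W (φ z) (V z)) x)
    ?_ ?_ ?_ ?_ hV
  · intro V V' _ h hP
    exact hP.congr (h.mono fun z hz ↦ by simp only [hz])
  · intro V V' _ _ h1 h2
    refine (h1.add hφ h2).congr (.of_forall fun z ↦ ?_)
    simp only [Pi.add_apply, map_add]
  · intro f V hf _ h
    refine (h.smul hφ hf).congr (.of_forall fun z ↦ ?_)
    simp only [Pi.smul_apply', map_smul]
  · intro w
    exact ((smoothField_extend w).leviCivita hW).along hφ

/-- `∇̄_X V` is smooth. -/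
theorem SmoothAlong.pullbackCov (hφ : ContMDiff I J ∞ φ) (hV : SmoothAlong I J φ V x)
    {X : Π x : M, TangentSpace I x} (hX : SmoothField I X x) :
    SmoothAlong I J φ (fun z ↦ pullbackCov I J φ V z (X z)) x := by
  refine SmoothAlong.induction hφ
    (P := fun V ↦ SmoothAlong I J φ (fun z ↦ RiemGeom.pullbackCov I J φ V z (X z)) x)
    ?_ ?_ ?_ ?_ hV
  · intro V V' _ h hP
    exact hP.congr (h.eventually_nhds.mono fun z hz ↦ by rw [pullbackCov_congr hz])
  · intro V V' hV hV' h1 h2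
    refine (h1.add hφ h2).congr ?_
    filter_upwards [hV.eventually, hV'.eventually] with z h3 h4
    rw [pullbackCov_add hφ h3 h4, add_apply, Pi.add_apply]
  · intro f V hf hV h
    refine ((h.smul hφ hf).add hφ (hV.smul hφ (hf.mvfderiv_apply hX))).congr ?_
    filter_upwards [hf.eventually, hV.eventually] with z h3 h4
    rw [pullbackCov_smul hφ h3 h4, Pi.add_apply, Pi.smul_apply', Pi.smul_apply']
  · intro w
    have hw := smoothField_extend w
    refine ((hX.mfderiv_along hφ).leviCivita_comp hφ hw).congr ?_
    filter_upwards [hφ.continuous.continuousAt.eventually (SmoothNear.eventually hw)] with z hz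
    exact pullbackCov_comp hφ hz (X z)

end PullbackConnection

/-! ### Lie brackets and torsion -/

section Torsion

variable {E : Type*} [NormedAddCommGroup E] [NormedSpace ℝ E] [FiniteDimensional ℝ E]
  {H : Type*} [TopologicalSpace H] {I : ModelWithCorners ℝ E H} [I.Boundaryless]
  {M : Type*} [TopologicalSpace M] [ChartedSpace H M] [IsManifold I ∞ M]

/-- The coordinates of a field in the preferred chart at `x`. -/
theorem coordAt_eq_mfderiv {F : Type*} [NormedAddCommGroup F] [NormedSpace ℝ F]
    {G : Type*} [TopologicalSpace G] {J : ModelWithCorners ℝ F G}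
    {N : Type*} [TopologicalSpace N] [ChartedSpace G N] [IsManifold J ∞ N] {φ : M → N} {x z : M}
    (hz : φ z ∈ (trivializationAt F (fun y : N ↦ TangentSpace J y) (φ x)).baseSet)
    (V : Π x : M, TangentSpace J (φ x)) :
    coordAt x V z = mfderiv J 𝓘(ℝ, F) (extChartAt J (φ x)) (φ z) (V z) := by
  have h1 := TangentBundle.continuousLinearMapAt_trivializationAt (I := J) (x₀ := φ x) (x := φ z)
    (by simpa using hz)
  have h2 : coordAt x V z = Trivialization.continuousLinearMapAt ℝ
      (trivializationAt F (fun y : N ↦ TangentSpace J y) (φ x)) (φ z) (V z) := by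
    rw [Trivialization.continuousLinearMapAt_apply, Trivialization.linearMapAt_apply, if_pos hz]
    rfl
  rw [h2]
  exact congrArg (· (V z)) h1

variable {F' : Type*} [NormedAddCommGroup F'] [NormedSpace ℝ F']

theorem mvfderiv_comp_extChartAt {g : E → F'} {x z : M} (hz : z ∈ (chartAt H x).source)
    (hg : DifferentiableAt ℝ g (extChartAt I x z)) {f : M → F'}
    (hf : f =ᶠ[𝓝 z] fun z ↦ g (extChartAt I x z)) (v : TangentSpace I z) :
    mvfderiv I f z v
      = fderiv ℝ g (extChartAt I x z) (mfderiv I 𝓘(ℝ, E) (extChartAt I x) z v) := by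
  have h2 := mfderiv_comp (I' := 𝓘(ℝ, E)) z hg.mdifferentiableAt
    (mdifferentiableAt_extChartAt (I := I) hz)
  rw [mfderiv_eq_fderiv] at h2
  rw [mvfderiv, hf.mfderiv_eq]
  exact congrArg (· v) h2

theorem contDiffAt_comp_extChartAt_symm {ψ : M → F'} {x z : M} (hz : z ∈ (chartAt H x).source)
    (hψ : ContMDiffAt I 𝓘(ℝ, F') ∞ ψ z) :
    ContDiffAt ℝ ∞ (ψ ∘ (extChartAt I x).symm) (extChartAt I x z) := by
  have hz' : z ∈ (extChartAt I x).source := by rwa [extChartAt_source]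
  have h1 := (contMDiffOn_extChartAt_symm (I := I) (n := ∞) x).contMDiffAt
    (extChartAt_target_mem_nhds' (I := I) ((extChartAt I x).map_source hz'))
  have h2 : ContMDiffAt I 𝓘(ℝ, F') ∞ ψ ((extChartAt I x).symm (extChartAt I x z)) := by
    rwa [(extChartAt I x).left_inv hz']
  exact (h2.comp _ h1).contDiffAt

/-- In the chart at `x`, the derivative of `ψ` along `Y` is the derivative of the representative of
`ψ` in the direction of the coordinate vector of `Y`. -/
theorem mvfderiv_eq_fderiv_coordAt {ψ : M → F'} {x : M} (hψ : SmoothNear I 𝓘(ℝ, F') ψ x)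
    (Y : Π x : M, TangentSpace I x) :
    ∀ᶠ z in 𝓝 x, mvfderiv I ψ z (Y z)
      = fderiv ℝ (ψ ∘ (extChartAt I x).symm) (extChartAt I x z)
        (coordAt (φ := fun z : M ↦ z) x Y z) := by
  filter_upwards [hψ, eventually_mem_baseSet_self (J := I) x,
    (chartAt H x).open_source.mem_nhds (mem_chart_source H x)] with z h1 h2 h3
  rw [coordAt_eq_mfderiv (φ := fun z : M ↦ z) h2]
  refine mvfderiv_comp_extChartAt h3
    ((contDiffAt_comp_extChartAt_symm h3 h1).differentiableAt (by simp)) ?_ _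
  filter_upwards [(chartAt H x).open_source.mem_nhds h3] with y hy
  rw [Function.comp_apply, (extChartAt I x).left_inv (by rwa [extChartAt_source])]

/-- The coordinate representative of a smooth field. -/
theorem coordAt_comp_symm_eq_mpullback {x : M} (X : Π x : M, TangentSpace I x) :
    mpullbackWithin 𝓘(ℝ, E) I (extChartAt I x).symm X (Set.range I)
      =ᶠ[𝓝 (extChartAt I x x)]
        (coordAt (φ := fun z : M ↦ z) x X) ∘ (extChartAt I x).symm := by
  filter_upwards [extChartAt_target_mem_nhds (I := I) x] with p hp
  have hp' := (extChartAt I x).map_target hp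
  rw [mpullbackWithin_apply, Function.comp_apply,
    coordAt_eq_mfderiv (φ := fun z : M ↦ z) (by simpa using hp')]
  have h1 := mfderivWithin_extChartAt_symm_comp_mfderiv_extChartAt (I := I) hp
  have h2 := mfderiv_extChartAt_comp_mfderivWithin_extChartAt_symm (I := I) hp
  have h3 := ContinuousLinearMap.inverse_eq h1 h2
  rw [h3]
  rfl

/-- `X (Y ψ) - Y (X ψ) = [X, Y] ψ` for a vector-valued function `ψ`. -/
theorem mvfderiv_mlieBracket {ψ : M → F'} {x : M} (hψ : SmoothNear I 𝓘(ℝ, F') ψ x)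
    {X Y : Π x : M, TangentSpace I x} (hX : SmoothField I X x) (hY : SmoothField I Y x) :
    mvfderiv I (fun z ↦ mvfderiv I ψ z (Y z)) x (X x)
      - mvfderiv I (fun z ↦ mvfderiv I ψ z (X z)) x (Y x)
      = mvfderiv I ψ x (mlieBracket I X Y x) := by
  let χ := extChartAt I x
  let g := ψ ∘ χ.symm
  let c (X : Π x : M, TangentSpace I x) : E → E := coordAt (φ := fun z : M ↦ z) x X ∘ χ.symm
  have hid : ContMDiff I I ∞ (fun z : M ↦ z) := contMDiff_id
  have hx := mem_chart_source H x
  have hg : ContDiffAt ℝ ∞ g (χ x) := contDiffAt_comp_extChartAt_symm hx hψ.contMDiffAt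
  have hdg : DifferentiableAt ℝ (fderiv ℝ g) (χ x) :=
    (hg.fderiv_right (m := 1) (by norm_cast)).differentiableAt (by simp)
  have hc {X : Π x : M, TangentSpace I x} (hX : SmoothField I X x) :
      DifferentiableAt ℝ (c X) (χ x) :=
    (contDiffAt_comp_extChartAt_symm hx ((smoothAlong_iff hid).1 hX).contMDiffAt).differentiableAt
      (by simp)
  have hcx (X : Π x : M, TangentSpace I x) : c X (χ x) = X x := by
    have h1 := coordAt_eq_mfderiv (J := I) (φ := fun z : M ↦ z)
      (mem_baseSet_trivializationAt' x) X
    simp only [c, Function.comp_apply]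
    rw [show χ.symm (χ x) = x from extChartAt_to_inv x, h1, mfderiv_extChartAt_self]
    rfl
  have key {X Y : Π x : M, TangentSpace I x} (hY : SmoothField I Y x) :
      mvfderiv I (fun z ↦ mvfderiv I ψ z (Y z)) x (X x)
        = fderiv ℝ (fderiv ℝ g) (χ x) (c X (χ x)) (c Y (χ x))
          + fderiv ℝ g (χ x) (fderiv ℝ (c Y) (χ x) (c X (χ x))) := by
    have h1 : (fun z ↦ mvfderiv I ψ z (Y z)) =ᶠ[𝓝 x]
        fun z ↦ (fun p ↦ fderiv ℝ g p (c Y p)) (χ z) := by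
      filter_upwards [mvfderiv_eq_fderiv_coordAt hψ Y,
        (chartAt H x).open_source.mem_nhds hx] with z h2 h3
      rw [h2]
      simp only [c, Function.comp_apply]
      rw [show χ.symm (χ z) = z from (extChartAt I x).left_inv (by rwa [extChartAt_source])]
    rw [mvfderiv_comp_extChartAt hx (hdg.clm_apply (hc hY)) h1, mfderiv_extChartAt_self,
      fderiv_clm_apply hdg (hc hY), hcx X]
    exact add_comm (fderiv ℝ g (χ x) (fderiv ℝ (c Y) (χ x) (X x))) _
  have hsymm : fderiv ℝ (fderiv ℝ g) (χ x) (c X (χ x)) (c Y (χ x))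
      = fderiv ℝ (fderiv ℝ g) (χ x) (c Y (χ x)) (c X (χ x)) :=
    (hg.isSymmSndFDerivAt (by simp; norm_cast)).eq _ _
  have hbr : (mlieBracket I X Y x : E)
      = fderiv ℝ (c Y) (χ x) (c X (χ x)) - fderiv ℝ (c X) (χ x) (c Y (χ x)) := by
    have h1 : (mfderiv I 𝓘(ℝ, E) (extChartAt I x) x).inverse
        = ContinuousLinearMap.id ℝ E := by
      rw [mfderiv_extChartAt_self]
      exact ContinuousLinearMap.inverse_id
    let p (X : Π x : M, TangentSpace I x) : E → E :=
      mpullbackWithin 𝓘(ℝ, E) I (extChartAt I x).symm X (Set.range I)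
    have hp (X) : p X =ᶠ[𝓝 (χ x)] c X := coordAt_comp_symm_eq_mpullback X
    have h2 : (mlieBracket I X Y x : E) = (mfderiv I 𝓘(ℝ, E) (extChartAt I x) x).inverse
        (lieBracketWithin (E := E) ℝ (p X) (p Y) (χ.symm ⁻¹' Set.univ ∩ Set.range I) (χ x)) :=
      mlieBracketWithin_apply
    have h3 : lieBracketWithin ℝ (p X) (p Y) (χ.symm ⁻¹' Set.univ ∩ Set.range I) (χ x)
        = lieBracket ℝ (c X) (c Y) (χ x) := by
      have h4 : (χ.symm ⁻¹' Set.univ ∩ Set.range I) = Set.univ := by simp [I.range_eq_univ]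
      rw [h4, lieBracketWithin_univ]
      exact (hp X).lieBracket_vectorField_eq (hp Y)
    rw [h2, h3]
    exact congrArg (fun L : E →L[ℝ] E ↦ L (lieBracket (E := E) ℝ (c X) (c Y) (χ x))) h1
  have hψx : mvfderiv I ψ x (mlieBracket I X Y x) = fderiv ℝ g (χ x) (mlieBracket I X Y x) := by
    have h1 := (mvfderiv_eq_fderiv_coordAt hψ (mlieBracket I X Y)).self_of_nhds
    have h2 := hcx (mlieBracket I X Y)
    simp only [c, Function.comp_apply] at h2
    rw [show χ.symm (χ x) = x from extChartAt_to_inv x] at h2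
    rw [h1, h2]
  rw [key hY, key hX, hψx, hbr, hsymm, map_sub]
  abel

/-- Fields with constant coefficients in the chart at `y` commute at `y`. -/
theorem mlieBracket_extend (y : M) (u v : TangentSpace I y) :
    mlieBracket I (extend E u) (extend E v) y = 0 := by
  have h0 : SmoothNear I 𝓘(ℝ, E) (extChartAt I y) y := by
    filter_upwards [(chartAt H y).open_source.mem_nhds (mem_chart_source H y)] with z hz
    exact contMDiffAt_extChartAt' hz
  have h1 (w : TangentSpace I y) (a : TangentSpace I y) :
      mvfderiv I (fun z ↦ mvfderiv I (extChartAt I y) z (extend E w z)) y a = 0 := by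
    have h2 : (fun z ↦ mvfderiv I (extChartAt I y) z (extend E w z)) =ᶠ[𝓝 y] fun _ ↦
        (trivializationAt E (fun y : M ↦ TangentSpace I y) y ⟨y, w⟩).2 := by
      filter_upwards [eventually_mem_baseSet_self (J := I) y] with z hz
      refine (coordAt_eq_mfderiv (φ := fun z : M ↦ z) hz (extend E w)).symm.trans ?_
      simp only [coordAt, extend]
      rw [Trivialization.apply_mk_symm _ hz]
    rw [mvfderiv_congr h2, mvfderiv_const, zero_apply]
  have h3 := mvfderiv_mlieBracket h0 (smoothField_extend u) (smoothField_extend v)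
  rw [h1, h1, sub_zero, mvfderiv, mfderiv_extChartAt_self] at h3
  exact h3.symm

theorem leviCivita_sub_eq_mlieBracket [RiemannianBundle (fun x : M ↦ TangentSpace I x)]
    [IsContMDiffRiemannianBundle I ∞ E (fun x : M ↦ TangentSpace I x)]
    {X Y : Π x : M, TangentSpace I x} {x : M} (hX : SmoothField I X x) (hY : SmoothField I Y x) :
    leviCivita I Y x (X x) - leviCivita I X x (Y x) = mlieBracket I X Y x :=
  ((CovariantDerivative.torsion_eq_zero_iff _).1 (leviCivita_torsion I (M := M)))
    hX.mdifferentiableAt hY.mdifferentiableAt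

variable {F : Type*} [NormedAddCommGroup F] [NormedSpace ℝ F] [FiniteDimensional ℝ F]
  {G : Type*} [TopologicalSpace G] {J : ModelWithCorners ℝ F G} [J.Boundaryless]
  {N : Type*} [TopologicalSpace N] [ChartedSpace G N] [IsManifold J ∞ N]
  [RiemannianBundle (fun y : N ↦ TangentSpace J y)]
  [IsContMDiffRiemannianBundle J ∞ F (fun y : N ↦ TangentSpace J y)]
  {φ : M → N}

/-- The induced connection is torsion-free. -/
theorem pullbackCov_mfderiv_sub (hφ : ContMDiff I J ∞ φ) {x : M}
    {X Y : Π x : M, TangentSpace I x} (hX : SmoothField I X x) (hY : SmoothField I Y x) :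
    pullbackCov I J φ (fun z ↦ mfderiv I J φ z (Y z)) x (X x)
      - pullbackCov I J φ (fun z ↦ mfderiv I J φ z (X z)) x (Y x)
      = mfderiv I J φ x (mlieBracket I X Y x) := by
  let ψ (z : M) : F := extChartAt J (φ x) (φ z)
  have hsrc : ∀ᶠ z in 𝓝 x, φ z ∈ (chartAt G (φ x)).source :=
    hφ.continuous.continuousAt.eventually
      ((chartAt G (φ x)).open_source.mem_nhds (mem_chart_source G (φ x)))
  have hψ : SmoothNear I 𝓘(ℝ, F) ψ x := by
    filter_upwards [hsrc] with z hz
    exact (contMDiffAt_extChartAt' hz).comp z (hφ z)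
  have h1 (Z : Π x : M, TangentSpace I x) : coordAt x (fun z ↦ mfderiv I J φ z (Z z))
      =ᶠ[𝓝 x] fun z ↦ mvfderiv I ψ z (Z z) := by
    filter_upwards [hsrc, eventually_mem_baseSet (J := J) hφ.continuous.continuousAt] with z h2 h3
    rw [coordAt_eq_mfderiv h3]
    exact (mfderiv_comp_apply z (mdifferentiableAt_extChartAt (I := J) h2)
      (hφ.mdifferentiable (by simp) z) (Z z)).symm
  have h2 (Z : Π x : M, TangentSpace I x) (v : TangentSpace I x) :
      mvfderiv I (coordAt x (fun z ↦ mfderiv I J φ z (Z z))) x v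
        = mvfderiv I (fun z ↦ mvfderiv I ψ z (Z z)) x v := by
    rw [mvfderiv_congr (h1 Z)]
  have h3 := leviCivita_sub_eq_mlieBracket (smoothField_extend (mfderiv I J φ x (X x)))
    (smoothField_extend (mfderiv I J φ x (Y x)))
  rw [mlieBracket_extend, extend_apply_self, extend_apply_self] at h3
  have h4 := mvfderiv_mlieBracket hψ hX hY
  have hx := mem_baseSet_trivializationAt' (F := F) (E := fun y : N ↦ TangentSpace J y) (φ x)
  have h5 := Trivialization.symmL_continuousLinearMapAt (R := ℝ)
      (trivializationAt F (fun y : N ↦ TangentSpace J y) (φ x)) hx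
      (mfderiv I J φ x (mlieBracket I X Y x))
  have h6 := (h1 (mlieBracket I X Y)).eq_of_nhds
  rw [Trivialization.continuousLinearMapAt_apply, Trivialization.linearMapAt_apply,
      if_pos hx] at h5
  simp only [coordAt] at h6
  rw [h6, ← h4, map_sub] at h5
  rw [pullbackCov_apply, pullbackCov_apply, h2, h2, ← h5, ← sub_eq_zero, ← h3]
  abel

end Torsion

/-! ### The curvature of the induced connection -/

section PullbackCurvature

variable {E : Type*} [NormedAddCommGroup E] [NormedSpace ℝ E] [FiniteDimensional ℝ E]
  {H : Type*} [TopologicalSpace H] {I : ModelWithCorners ℝ E H} [I.Boundaryless]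
  {M : Type*} [TopologicalSpace M] [ChartedSpace H M] [IsManifold I ∞ M]
  {F : Type*} [NormedAddCommGroup F] [NormedSpace ℝ F] [FiniteDimensional ℝ F]
  {G : Type*} [TopologicalSpace G] {J : ModelWithCorners ℝ F G} [J.Boundaryless]
  {N : Type*} [TopologicalSpace N] [ChartedSpace G N] [IsManifold J ∞ N]
  [RiemannianBundle (fun y : N ↦ TangentSpace J y)]
  [IsContMDiffRiemannianBundle J ∞ F (fun y : N ↦ TangentSpace J y)]
  {φ : M → N}

variable (I J φ) in
/-- The curvature of the induced connection on `φ⁻¹TN`: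
`∇̄_X ∇̄_Y V - ∇̄_Y ∇̄_X V - ∇̄_[X, Y] V`. -/
def pullbackCurvature (X Y : Π x : M, TangentSpace I x) (V : Π x : M, TangentSpace J (φ x))
    (x : M) : TangentSpace J (φ x) :=
  pullbackCov I J φ (fun z ↦ pullbackCov I J φ V z (Y z)) x (X x)
    - pullbackCov I J φ (fun z ↦ pullbackCov I J φ V z (X z)) x (Y x)
    - pullbackCov I J φ V x (mlieBracket I X Y x)

variable {X Y : Π x : M, TangentSpace I x} {V W : Π x : M, TangentSpace J (φ x)} {x : M}

/-- The curvature of the induced metric connection is skew-symmetric. -/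
theorem inner_pullbackCurvature (hφ : ContMDiff I J ∞ φ) (hX : SmoothField I X x)
    (hY : SmoothField I Y x) (hV : SmoothAlong I J φ V x) (hW : SmoothAlong I J φ W x) :
    inner ℝ (pullbackCurvature I J φ X Y V x) (W x)
      = -inner ℝ (V x) (pullbackCurvature I J φ X Y W x) := by
  have key {X Y : Π x : M, TangentSpace I x} (hX : SmoothField I X x) (hY : SmoothField I Y x) :
      mvfderiv I (fun z ↦ mvfderiv I (fun z ↦ inner ℝ (V z) (W z)) z (Y z)) x (X x)
        = inner ℝ (pullbackCov I J φ (fun z ↦ pullbackCov I J φ V z (Y z)) x (X x)) (W x)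
          + inner ℝ (pullbackCov I J φ V x (Y x)) (pullbackCov I J φ W x (X x))
          + (inner ℝ (pullbackCov I J φ V x (X x)) (pullbackCov I J φ W x (Y x))
          + inner ℝ (V x) (pullbackCov I J φ (fun z ↦ pullbackCov I J φ W z (Y z)) x (X x))) := by
    have h1 : (fun z ↦ mvfderiv I (fun z ↦ inner ℝ (V z) (W z)) z (Y z)) =ᶠ[𝓝 x]
        fun z ↦ inner ℝ (pullbackCov I J φ V z (Y z)) (W z)
          + inner ℝ (V z) (pullbackCov I J φ W z (Y z)) := by
      filter_upwards [hV.eventually, hW.eventually] with z h2 h3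
      exact pullbackCov_metric hφ h2 h3 (Y z)
    have hV' := hV.pullbackCov hφ hY
    have hW' := hW.pullbackCov hφ hY
    rw [← pullbackCov_metric hφ hV' hW, ← pullbackCov_metric hφ hV hW', ← add_apply,
      ← mvfderiv_fun_add (hV'.inner hW).mdifferentiableAt (hV.inner hW').mdifferentiableAt,
      mvfderiv_congr h1]
  have h1 := mvfderiv_mlieBracket (hV.inner hW) hX hY
  rw [key hX hY, key hY hX, pullbackCov_metric hφ hV hW] at h1
  simp only [pullbackCurvature, inner_sub_left, inner_sub_right]
  linarith

theorem leviCivita_extend_add_comp {W : Π y : N, TangentSpace J y} {y : N} (hW : SmoothField J W y)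
    (u v a : TangentSpace J y) :
    leviCivita J (fun z ↦ leviCivita J W z (extend F (u + v) z)) y a
      = leviCivita J (fun z ↦ leviCivita J W z (extend F u z)) y a
        + leviCivita J (fun z ↦ leviCivita J W z (extend F v z)) y a := by
  have hu := (smoothField_extend u).leviCivita hW
  have hv := (smoothField_extend v).leviCivita hW
  rw [← add_apply, ← leviCivita_add hu hv]
  refine congrArg (· a) (leviCivita_congr (SmoothAlong.add (φ := fun z ↦ z) contMDiff_id hu hv)
    ((extend_add y u v).mono fun z hz ↦ ?_))
  rw [hz, map_add]
  rfl

theorem leviCivita_extend_smul_comp {W : Π y : N, TangentSpace J y} {y : N}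
    (hW : SmoothField J W y) (c : ℝ) (u a : TangentSpace J y) :
    leviCivita J (fun z ↦ leviCivita J W z (extend F (c • u) z)) y a
      = c • leviCivita J (fun z ↦ leviCivita J W z (extend F u z)) y a := by
  have hu := (smoothField_extend u).leviCivita hW
  rw [← smul_apply, ← (leviCivita J).isCovariantDerivativeOnUniv.smul_const c
    hu.mdifferentiableAt]
  refine congrArg (· a) (leviCivita_congr (SmoothAlong.smul (φ := fun z ↦ z) contMDiff_id
    (SmoothNear.const c) hu) ((extend_smul y c u).mono fun z hz ↦ ?_))
  rw [hz, map_smul]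
  rfl

/-- The induced derivative of `∇_V W` for a field `W` on `N` and a field `V` along `φ`: the
second covariant derivative of `W` appears, written with extensions of vectors at `φ x`. -/
theorem pullbackCov_leviCivita_comp (hφ : ContMDiff I J ∞ φ) {W : Π y : N, TangentSpace J y}
    (hW : SmoothField J W (φ x)) (hV : SmoothAlong I J φ V x) (v : TangentSpace I x) :
    pullbackCov I J φ (fun z ↦ leviCivita J W (φ z) (V z)) x v
      = leviCivita J W (φ x) (pullbackCov I J φ V x v)
        + (leviCivita J (fun y ↦ leviCivita J W y (extend F (V x) y)) (φ x) (mfderiv I J φ x v)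
        - leviCivita J W (φ x) (leviCivita J (extend F (V x)) (φ x) (mfderiv I J φ x v))) := by
  refine SmoothAlong.induction hφ (P := fun V ↦
    pullbackCov I J φ (fun z ↦ leviCivita J W (φ z) (V z)) x v
      = leviCivita J W (φ x) (pullbackCov I J φ V x v)
        + (leviCivita J (fun y ↦ leviCivita J W y (extend F (V x) y)) (φ x) (mfderiv I J φ x v)
        - leviCivita J W (φ x) (leviCivita J (extend F (V x)) (φ x) (mfderiv I J φ x v))))
    ?_ ?_ ?_ ?_ hV
  · intro V V' _ h hP
    rw [pullbackCov_congr h, h.self_of_nhds, ← hP]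
    have h' : ∀ᶠ z in 𝓝 x, leviCivita J W (φ z) (V' z) = leviCivita J W (φ z) (V z) :=
      h.mono fun z hz ↦ by rw [hz]
    exact congrArg (· v) (pullbackCov_congr (I := I) (J := J) (φ := φ)
      (V := fun z ↦ leviCivita J W (φ z) (V z)) (W := fun z ↦ leviCivita J W (φ z) (V' z)) h')
  · intro V V' hV hV' h1 h2
    have h3 := pullbackCov_add hφ (hV.leviCivita_comp hφ hW) (hV'.leviCivita_comp hφ hW)
    have h4 : pullbackCov I J φ (fun z ↦ leviCivita J W (φ z) ((V + V') z)) x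
        = pullbackCov I J φ ((fun z ↦ leviCivita J W (φ z) (V z))
          + fun z ↦ leviCivita J W (φ z) (V' z)) x :=
      pullbackCov_congr (.of_forall fun z ↦ map_add (leviCivita J W (φ z)) (V z) (V' z))
    rw [h4, h3, pullbackCov_add hφ hV hV', add_apply, add_apply, h1, h2, Pi.add_apply,
      leviCivita_extend_add_comp hW, leviCivita_extend_add, add_apply, map_add, map_add]
    abel
  · intro f V hf hV h
    have h3 := pullbackCov_smul hφ hf (hV.leviCivita_comp hφ hW) v
    have h4 : pullbackCov I J φ (fun z ↦ leviCivita J W (φ z) ((f • V) z)) x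
        = pullbackCov I J φ (f • fun z ↦ leviCivita J W (φ z) (V z)) x :=
      pullbackCov_congr (.of_forall fun z ↦ map_smul (leviCivita J W (φ z)) (f z) (V z))
    rw [h4, h3, pullbackCov_smul hφ hf hV, h, Pi.smul_apply', leviCivita_extend_smul_comp hW,
      leviCivita_extend_smul, smul_apply, map_add, map_smul, map_smul, map_smul, smul_add,
      smul_sub]
    abel
  · intro w
    have h1 := pullbackCov_comp hφ ((smoothField_extend w).leviCivita hW) v
    rw [pullbackCov_comp hφ (smoothField_extend w)]
    beta_reduce
    rw [extend_apply_self]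
    refine h1.trans ?_
    abel

theorem pullbackCurvature_comp (hφ : ContMDiff I J ∞ φ) {W : Π y : N, TangentSpace J y}
    (hW : SmoothField J W (φ x)) (hX : SmoothField I X x) (hY : SmoothField I Y x) :
    pullbackCurvature I J φ X Y (fun z ↦ W (φ z)) x
      = curvatureField J (extend F (mfderiv I J φ x (X x))) (extend F (mfderiv I J φ x (Y x)))
        W (φ x) := by
  have key {X Y : Π x : M, TangentSpace I x} (hY : SmoothField I Y x) :
      pullbackCov I J φ (fun z ↦ pullbackCov I J φ (fun z ↦ W (φ z)) z (Y z)) x (X x)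
        = _ :=
    (congrArg (· (X x)) (pullbackCov_congr (by
      filter_upwards [hφ.continuous.continuousAt.eventually (SmoothNear.eventually hW)] with z hz
      exact pullbackCov_comp hφ hz (Y z)))).trans
    (pullbackCov_leviCivita_comp hφ hW (hY.mfderiv_along hφ) (X x))
  have h1 := pullbackCov_mfderiv_sub (J := J) hφ hX hY
  have h2 := leviCivita_sub_eq_mlieBracket (smoothField_extend (mfderiv I J φ x (X x)))
    (smoothField_extend (mfderiv I J φ x (Y x)))
  rw [extend_apply_self, extend_apply_self] at h2
  rw [pullbackCurvature, key hY, key hX, pullbackCov_comp hφ hW, ← h1, curvatureField, ← h2,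
    extend_apply_self, extend_apply_self, map_sub, map_sub]
  abel

end PullbackCurvature

/-! ### The symmetries of the curvature tensor -/

section CurvatureTensor

variable {F : Type*} [NormedAddCommGroup F] [NormedSpace ℝ F] [FiniteDimensional ℝ F]
  {G : Type*} [TopologicalSpace G] {J : ModelWithCorners ℝ F G} [J.Boundaryless]
  {N : Type*} [TopologicalSpace N] [ChartedSpace G N] [IsManifold J ∞ N]
  [RiemannianBundle (fun y : N ↦ TangentSpace J y)]
  [IsContMDiffRiemannianBundle J ∞ F (fun y : N ↦ TangentSpace J y)]

variable {U V W Z : Π y : N, TangentSpace J y} {y : N}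

theorem pullbackCov_id (hW : SmoothField J W y) (v : TangentSpace J y) :
    pullbackCov J J (fun z : N ↦ z) W y v = leviCivita J W y v := by
  have h1 := pullbackCov_comp (φ := fun z : N ↦ z) (I := J) contMDiff_id hW v
  have h2 : mfderiv J J (fun z : N ↦ z) y v = v := congrArg (· v) (mfderiv_id (I := J) (x := y))
  exact h1.trans (congrArg (leviCivita J W y) h2)

theorem pullbackCurvature_id (hU : SmoothField J U y) (hV : SmoothField J V y)
    (hW : SmoothField J W y) :
    pullbackCurvature J J (fun z : N ↦ z) U V W y = curvatureField J U V W y := by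
  have key {V : Π y : N, TangentSpace J y} (hV : SmoothField J V y) (v : TangentSpace J y) :
      pullbackCov J J (fun z : N ↦ z) (fun z ↦ pullbackCov J J (fun z : N ↦ z) W z (V z)) y v
        = leviCivita J (fun z ↦ leviCivita J W z (V z)) y v := by
    have h1 : ∀ᶠ z in 𝓝 y, pullbackCov J J (fun z : N ↦ z) W z (V z)
        = leviCivita J W z (V z) :=
      (SmoothNear.eventually hW).mono fun z hz ↦ pullbackCov_id hz (V z)
    exact (congrArg (· v) (pullbackCov_congr (φ := fun z : N ↦ z) (I := J) h1)).trans
      (pullbackCov_id (hV.leviCivita hW) v)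
  rw [pullbackCurvature, key hV, key hU, pullbackCov_id hW, curvatureField]

theorem inner_curvatureField (hU : SmoothField J U y) (hV : SmoothField J V y)
    (hW : SmoothField J W y) (hZ : SmoothField J Z y) :
    inner ℝ (curvatureField J U V W y) (Z y) = -inner ℝ (W y) (curvatureField J U V Z y) := by
  rw [← pullbackCurvature_id hU hV hW, ← pullbackCurvature_id hU hV hZ]
  exact inner_pullbackCurvature (φ := fun z : N ↦ z) contMDiff_id hU hV hW hZ

variable (y) (u v w z : TangentSpace J y)

theorem inner_curvature_skew :
    inner ℝ (curvature J y u v w) z = -inner ℝ (curvature J y u v z) w := by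
  have h := inner_curvatureField (smoothField_extend u) (smoothField_extend v)
    (smoothField_extend w) (smoothField_extend z)
  rw [extend_apply_self, extend_apply_self] at h
  rw [curvature, h, real_inner_comm, curvature]

theorem curvature_swap : curvature J y u v w = -curvature J y v u w := by
  rw [curvature, curvature, curvatureField, curvatureField, mlieBracket_extend,
    mlieBracket_extend, map_zero]
  abel

theorem curvature_bianchi :
    curvature J y u v w + curvature J y v w u + curvature J y w u v = 0 := by
  have key (u v w : TangentSpace J y) :
      leviCivita J (fun z ↦ leviCivita J (extend F w) z (extend F v z)) y u
        - leviCivita J (fun z ↦ leviCivita J (extend F v) z (extend F w z)) y u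
        = mlieBracket J (extend F u) (mlieBracket J (extend F v) (extend F w)) y := by
    have hu := smoothField_extend u
    have hv := smoothField_extend v
    have hw := smoothField_extend w
    have h1 := leviCivita_sub_eq_mlieBracket hu (hv.mlieBracket hw)
    rw [mlieBracket_extend, map_zero, sub_zero, extend_apply_self] at h1
    rw [← h1]
    have h2 := leviCivita_add ((hv.mlieBracket hw)) (hw.leviCivita hv)
    have h3 : leviCivita J (fun z ↦ leviCivita J (extend F w) z (extend F v z)) y
        = leviCivita J (mlieBracket J (extend F v) (extend F w)
          + fun z ↦ leviCivita J (extend F v) z (extend F w z)) y := by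
      refine leviCivita_congr (SmoothAlong.add (φ := fun z ↦ z) contMDiff_id
        (hv.mlieBracket hw) (hw.leviCivita hv)) ?_
      filter_upwards [SmoothNear.eventually hv, SmoothNear.eventually hw] with z h4 h5
      exact sub_eq_iff_eq_add.1 (leviCivita_sub_eq_mlieBracket h4 h5)
    rw [h3, h2, add_apply]
    abel
  have : IsManifold J (minSmoothness ℝ 3) N := by
    rw [minSmoothness_of_isRCLikeNormedField]
    infer_instance
  have hs (v : TangentSpace J y) : ContMDiffAt J J.tangent (minSmoothness ℝ 2)
      (T% (extend F v)) y := by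
    rw [minSmoothness_of_isRCLikeNormedField]
    exact (SmoothNear.contMDiffAt (smoothField_extend v)).of_le (by norm_cast)
  have hJ := leibniz_identity_mlieBracket_apply (hs u) (hs v) (hs w)
  have h1 := key u v w
  have h2 := key v u w
  have h3 := key w u v
  have h4 : mlieBracket J (extend F w) (mlieBracket J (extend F u) (extend F v)) y
      = -mlieBracket J (mlieBracket J (extend F u) (extend F v)) (extend F w) y :=
    mlieBracket_swap_apply
  rw [hJ] at h1
  rw [h4] at h3
  simp only [curvature, curvatureField, mlieBracket_extend, map_zero, extend_apply_self, sub_zero]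
  have h5 := congrArg₂ (· + ·) (congrArg₂ (· - ·) h1 h2) h3
  beta_reduce at h5
  rw [add_sub_cancel_right, add_neg_cancel] at h5
  rw [← h5]
  abel

theorem inner_curvature_pair_symm :
    inner ℝ (curvature J y u v w) z = inner ℝ (curvature J y w z u) v := by
  have h (a b c d : TangentSpace J y) : inner ℝ (curvature J y a b c) d
      + inner ℝ (curvature J y b c a) d + inner ℝ (curvature J y c a b) d = (0 : ℝ) := by
    rw [← inner_add_left, ← inner_add_left, curvature_bianchi, inner_zero_left]
  have hs (a b c d : TangentSpace J y) : (inner ℝ (curvature J y a b c) d : ℝ)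
      = -inner ℝ (curvature J y b a c) d := by rw [curvature_swap, inner_neg_left]
  have k := inner_curvature_skew (J := J) y
  -- in the sum of the four Bianchi identities, all but two pairs of equal terms cancel
  linarith [h v w u z, h w u z v, h u z v w, h z v w u, k v w z u, k w u z v, k u z w v, k z v w u,
    k u v z w, k w z v u, hs v u z w, hs z w u v]

theorem curvature_add_left (u' : TangentSpace J y) :
    curvature J y (u + u') v w = curvature J y u v w + curvature J y u' v w := by
  have hw := smoothField_extend w
  simp only [curvature, curvatureField, mlieBracket_extend, map_zero, sub_zero,
    extend_apply_self]
  rw [map_add, leviCivita_extend_add_comp hw]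
  abel

theorem curvature_smul_left (c : ℝ) : curvature J y (c • u) v w = c • curvature J y u v w := by
  have hw := smoothField_extend w
  simp only [curvature, curvatureField, mlieBracket_extend, map_zero, sub_zero,
    extend_apply_self]
  rw [map_smul, leviCivita_extend_smul_comp hw, smul_sub]

theorem curvature_add_middle (v' : TangentSpace J y) :
    curvature J y u (v + v') w = curvature J y u v w + curvature J y u v' w := by
  rw [curvature_swap, curvature_add_left, neg_add, ← curvature_swap, ← curvature_swap]

theorem curvature_smul_middle (c : ℝ) :
    curvature J y u (c • v) w = c • curvature J y u v w := by
  rw [curvature_swap, curvature_smul_left, ← smul_neg, ← curvature_swap]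

theorem curvature_add_right (w' : TangentSpace J y) :
    curvature J y u v (w + w') = curvature J y u v w + curvature J y u v w' := by
  refine ext_inner_right ℝ fun z ↦ ?_
  rw [inner_add_left, inner_curvature_skew, inner_add_right, inner_curvature_skew y u v w,
    inner_curvature_skew y u v w']
  ring

theorem curvature_smul_right (c : ℝ) :
    curvature J y u v (c • w) = c • curvature J y u v w := by
  refine ext_inner_right ℝ fun z ↦ ?_
  rw [real_inner_smul_left, inner_curvature_skew, real_inner_smul_right,
    inner_curvature_skew y u v w]
  ring

theorem curvature_self : curvature J y u u w = 0 := by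
  refine ext_inner_right ℝ fun z ↦ ?_
  have h := congrArg (fun a ↦ (inner ℝ a z : ℝ)) (curvature_swap y u u w)
  simp only [inner_neg_left] at h
  rw [inner_zero_left]
  linarith

variable (J) in
/-- The bilinear map `(v, w) ↦ R(u, v)w`. -/
def curvatureHom : TangentSpace J y →ₗ[ℝ] TangentSpace J y →ₗ[ℝ] TangentSpace J y :=
  LinearMap.mk₂ ℝ (curvature J y u) (fun v v' w ↦ curvature_add_middle y u v w v')
    (fun c v w ↦ curvature_smul_middle y u v w c) (fun v w w' ↦ curvature_add_right y u v w w')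
    (fun c v w ↦ curvature_smul_right y u v w c)

end CurvatureTensor

section PullbackCurvatureTensor

variable {E : Type*} [NormedAddCommGroup E] [NormedSpace ℝ E] [FiniteDimensional ℝ E]
  {H : Type*} [TopologicalSpace H] {I : ModelWithCorners ℝ E H} [I.Boundaryless]
  {M : Type*} [TopologicalSpace M] [ChartedSpace H M] [IsManifold I ∞ M]
  {F : Type*} [NormedAddCommGroup F] [NormedSpace ℝ F] [FiniteDimensional ℝ F]
  {G : Type*} [TopologicalSpace G] {J : ModelWithCorners ℝ F G} [J.Boundaryless]
  {N : Type*} [TopologicalSpace N] [ChartedSpace G N] [IsManifold J ∞ N]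
  [RiemannianBundle (fun y : N ↦ TangentSpace J y)]
  [IsContMDiffRiemannianBundle J ∞ F (fun y : N ↦ TangentSpace J y)]
  {φ : M → N}

/-- The curvature of the induced connection is the pullback of the curvature of `N`. -/
theorem pullbackCurvature_eq_curvature (hφ : ContMDiff I J ∞ φ) {X Y : Π x : M, TangentSpace I x}
    {V : Π x : M, TangentSpace J (φ x)} {x : M} (hX : SmoothField I X x)
    (hY : SmoothField I Y x) (hV : SmoothAlong I J φ V x) :
    pullbackCurvature I J φ X Y V x
      = curvature J (φ x) (mfderiv I J φ x (X x)) (mfderiv I J φ x (Y x)) (V x) := by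
  refine ext_inner_right ℝ fun z ↦ ?_
  have hz := smoothField_extend z
  have h1 := inner_pullbackCurvature hφ hX hY hV (hz.along hφ)
  rw [pullbackCurvature_comp hφ hz hX hY] at h1
  rw [extend_apply_self] at h1
  rw [h1, inner_curvature_skew, real_inner_comm]
  rfl

end PullbackCurvatureTensor

/-! ### The second fundamental form -/

/-- The trace of a bilinear map does not depend on the orthonormal basis. -/
theorem sum_orthonormalBasis_eq {V W : Type*} [NormedAddCommGroup V] [InnerProductSpace ℝ V]
    [AddCommGroup W] [Module ℝ W] {ι ι' : Type*} [Fintype ι] [Fintype ι']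
    (L : V →ₗ[ℝ] V →ₗ[ℝ] W) (b : OrthonormalBasis ι ℝ V) (b' : OrthonormalBasis ι' ℝ V) :
    ∑ i, L (b i) (b i) = ∑ j, L (b' j) (b' j) := by
  classical
  have h1 (i) : L (b i) (b i)
      = ∑ j, ∑ k, (inner ℝ (b' j) (b i) * inner ℝ (b i) (b' k) : ℝ) • L (b' j) (b' k) := by
    conv_lhs => rw [← b'.sum_repr' (b i)]
    simp only [map_sum, map_smul, LinearMap.sum_apply, LinearMap.smul_apply, Finset.smul_sum,
      smul_smul]
    rw [Finset.sum_comm]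
    refine Finset.sum_congr rfl fun j _ ↦ Finset.sum_congr rfl fun k _ ↦ ?_
    rw [mul_comm, real_inner_comm (b i) (b' k)]
  simp only [h1]
  rw [Finset.sum_comm]
  refine Finset.sum_congr rfl fun j _ ↦ ?_
  rw [Finset.sum_comm]
  simp only [← Finset.sum_smul, b.sum_inner_mul_inner]
  rw [Finset.sum_eq_single j, b'.inner_eq_one, one_smul]
  · intro k _ hk
    rw [b'.inner_eq_zero hk.symm, zero_smul]
  · simp

section SecondFundamentalForm

variable {E : Type*} [NormedAddCommGroup E] [NormedSpace ℝ E] [FiniteDimensional ℝ E]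
  {H : Type*} [TopologicalSpace H] {I : ModelWithCorners ℝ E H} [I.Boundaryless]
  {M : Type*} [TopologicalSpace M] [ChartedSpace H M] [IsManifold I ∞ M]
  [RiemannianBundle (fun x : M ↦ TangentSpace I x)]
  [IsContMDiffRiemannianBundle I ∞ E (fun x : M ↦ TangentSpace I x)]
  {F : Type*} [NormedAddCommGroup F] [NormedSpace ℝ F] [FiniteDimensional ℝ F]
  {G : Type*} [TopologicalSpace G] {J : ModelWithCorners ℝ F G} [J.Boundaryless]
  {N : Type*} [TopologicalSpace N] [ChartedSpace G N] [IsManifold J ∞ N]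
  [RiemannianBundle (fun y : N ↦ TangentSpace J y)]
  [IsContMDiffRiemannianBundle J ∞ F (fun y : N ↦ TangentSpace J y)]
  {φ : M → N} {x : M} {X Y : Π x : M, TangentSpace I x}

theorem secondFundamentalFormField_symm (hφ : ContMDiff I J ∞ φ) (hX : SmoothField I X x)
    (hY : SmoothField I Y x) :
    secondFundamentalFormField I J φ X Y x = secondFundamentalFormField I J φ Y X x := by
  have h1 := pullbackCov_mfderiv_sub (J := J) hφ hX hY
  rw [← leviCivita_sub_eq_mlieBracket hX hY, map_sub] at h1
  rw [secondFundamentalFormField, secondFundamentalFormField, sub_eq_sub_iff_sub_eq_sub, h1]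

/-- `secondFundamentalFormField` is tensorial. -/
theorem secondFundamentalFormField_eq (hφ : ContMDiff I J ∞ φ) (hY : SmoothField I Y x) :
    secondFundamentalFormField I J φ X Y x = secondFundamentalForm I J φ x (X x) (Y x) := by
  have h (X Y : Π x : M, TangentSpace I x) : secondFundamentalFormField I J φ X Y x
      = secondFundamentalFormField I J φ (extend E (X x)) Y x := by
    rw [secondFundamentalFormField, secondFundamentalFormField, extend_apply_self]
  have hX' := smoothField_extend (X x)
  rw [h, secondFundamentalFormField_symm hφ hX' hY, h,
    secondFundamentalFormField_symm hφ (smoothField_extend (Y x)) hX']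
  rfl

theorem secondFundamentalForm_symm (hφ : ContMDiff I J ∞ φ) (u v : TangentSpace I x) :
    secondFundamentalForm I J φ x u v = secondFundamentalForm I J φ x v u :=
  secondFundamentalFormField_symm hφ (smoothField_extend u) (smoothField_extend v)

/-- The second fundamental form as a bilinear map. -/
def secondFundamentalFormHom (hφ : ContMDiff I J ∞ φ) (x : M) :
    TangentSpace I x →ₗ[ℝ] TangentSpace I x →ₗ[ℝ] TangentSpace J (φ x) :=
  have add (u u' v) : secondFundamentalForm I J φ x (u + u') v
      = secondFundamentalForm I J φ x u v + secondFundamentalForm I J φ x u' v := by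
    simp only [secondFundamentalForm, secondFundamentalFormField, extend_apply_self, map_add]
    abel
  have smul (c : ℝ) (u v) : secondFundamentalForm I J φ x (c • u) v
      = c • secondFundamentalForm I J φ x u v := by
    simp only [secondFundamentalForm, secondFundamentalFormField, extend_apply_self, map_smul,
      smul_sub]
  LinearMap.mk₂ ℝ (secondFundamentalForm I J φ x) add smul
    (fun u v v' ↦ by
      rw [secondFundamentalForm_symm hφ, add, secondFundamentalForm_symm hφ v,
        secondFundamentalForm_symm hφ v'])
    (fun c u v ↦ by
      rw [secondFundamentalForm_symm hφ, smul, secondFundamentalForm_symm hφ v])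

/-- The Gauss formula. -/
theorem pullbackCov_mfderiv (hφ : ContMDiff I J ∞ φ) (hY : SmoothField I Y x)
    (v : TangentSpace I x) :
    pullbackCov I J φ (fun z ↦ mfderiv I J φ z (Y z)) x v
      = mfderiv I J φ x (leviCivita I Y x v) + secondFundamentalForm I J φ x v (Y x) := by
  have h := secondFundamentalFormField_eq (X := extend E v) hφ hY
  rw [secondFundamentalFormField, extend_apply_self] at h
  rw [← h]
  abel

/-- The second fundamental form of an isometric immersion is normal: the trilinear form
`⟨B(X, Y), dφ Z⟩` is symmetric in `X`, `Y` and antisymmetric in `Y`, `Z`, hence it vanishes. -/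
theorem inner_secondFundamentalForm_mfderiv (hφ : IsIsometricImmersion I J φ)
    (u v w : TangentSpace I x) :
    inner ℝ (secondFundamentalForm I J φ x u v) (mfderiv I J φ x w) = (0 : ℝ) := by
  have hs := hφ.contMDiff
  have anti (u v w : TangentSpace I x) :
      (inner ℝ (secondFundamentalForm I J φ x u v) (mfderiv I J φ x w) : ℝ)
        = -inner ℝ (secondFundamentalForm I J φ x u w) (mfderiv I J φ x v) := by
    have hv := smoothField_extend v
    have hw := smoothField_extend w
    have h1 := pullbackCov_metric hs (hv.mfderiv_along hs) (hw.mfderiv_along hs) u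
    have h2 := leviCivita_metric I hv.mdifferentiableAt hw.mdifferentiableAt u
    have h3 := pullbackCov_mfderiv hs hv u
    have h4 := pullbackCov_mfderiv hs hw u
    simp only [extend_apply_self] at h1 h2 h3 h4
    simp only [hφ.inner_mfderiv] at h1
    rw [h3, h4, h2, inner_add_left, inner_add_right, hφ.inner_mfderiv, hφ.inner_mfderiv] at h1
    rw [real_inner_comm (mfderiv I J φ x v)]
    linarith
  have symm := secondFundamentalForm_symm hs (x := x)
  have h1 := anti u v w
  rw [symm u w, anti w u v, symm w v, anti v w u, symm v u] at h1
  linarith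

theorem secondFundamentalForm_mem_normalSpace (hφ : IsIsometricImmersion I J φ)
    (u v : TangentSpace I x) : secondFundamentalForm I J φ x u v ∈ normalSpace I J φ x := by
  rw [normalSpace, Submodule.mem_orthogonal']
  rintro _ ⟨w, rfl⟩
  exact inner_secondFundamentalForm_mfderiv hφ u v w

theorem tension_eq_sum (hφ : ContMDiff I J ∞ φ) {ι : Type*} [Fintype ι]
    (b : OrthonormalBasis ι ℝ (TangentSpace I x)) :
    tension I J φ x = ∑ i, secondFundamentalForm I J φ x (b i) (b i) :=
  sum_orthonormalBasis_eq (secondFundamentalFormHom hφ x)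
    (stdOrthonormalBasis ℝ (TangentSpace I x)) b

theorem smoothAlong_tension (hφ : ContMDiff I J ∞ φ) :
    SmoothAlong I J φ (tension I J φ) x := by
  obtain ⟨f, h1, -, h2⟩ := exists_orthonormalFrame (stdOrthonormalBasis ℝ (TangentSpace I x))
  have h3 (i) : SmoothAlong I J φ (secondFundamentalFormField I J φ (f i) (f i)) x :=
    (((h1 i).mfderiv_along hφ).pullbackCov hφ (h1 i)).sub hφ
      (((h1 i).leviCivita (h1 i)).mfderiv_along hφ)
  refine (SmoothAlong.sum hφ (s := Finset.univ) fun i _ ↦ h3 i).congr ?_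
  filter_upwards [h2, eventually_all.2 fun i ↦ SmoothNear.eventually (h1 i)] with z ⟨b, hb⟩ h4
  rw [tension_eq_sum hφ b, Finset.sum_apply]
  refine Finset.sum_congr rfl fun i _ ↦ ?_
  rw [hb]
  exact (secondFundamentalFormField_eq hφ (h4 i)).symm

theorem tension_mem_normalSpace (hφ : IsIsometricImmersion I J φ) :
    tension I J φ x ∈ normalSpace I J φ x :=
  Submodule.sum_mem _ fun _ _ ↦ secondFundamentalForm_mem_normalSpace hφ _ _

theorem inner_mfderiv_of_mem_normalSpace {n : TangentSpace J (φ x)}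
    (hn : n ∈ normalSpace I J φ x) (v : TangentSpace I x) :
    inner ℝ n (mfderiv I J φ x v) = (0 : ℝ) :=
  (Submodule.mem_orthogonal' _ _).1 hn _ ⟨v, rfl⟩

/-- The shape operator is the adjoint of the second fundamental form. -/
theorem inner_pullbackCov_mfderiv (hφ : IsIsometricImmersion I J φ)
    {V : Π x : M, TangentSpace J (φ x)} (hV : SmoothAlong I J φ V x)
    (hn : ∀ z, V z ∈ normalSpace I J φ z) (u v : TangentSpace I x) :
    inner ℝ (pullbackCov I J φ V x u) (mfderiv I J φ x v)
      = (-inner ℝ (V x) (secondFundamentalForm I J φ x u v) : ℝ) := by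
  have hs := hφ.contMDiff
  have hv := smoothField_extend v
  have h1 := pullbackCov_metric hs hV (hv.mfderiv_along hs) u
  have h2 := pullbackCov_mfderiv hs hv u
  have h3 : (fun z ↦ (inner ℝ (V z) (mfderiv I J φ z (extend E v z)) : ℝ)) = fun _ ↦ 0 :=
    funext fun z ↦ inner_mfderiv_of_mem_normalSpace (hn z) _
  simp only [extend_apply_self] at h1 h2
  rw [h3, h2, inner_add_right, inner_mfderiv_of_mem_normalSpace (hn x),
    mvfderiv_const, zero_apply] at h1
  linarith

/-- If the normal component of `∇̄_v V` vanishes, then `∇̄_v V` is tangential. -/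
theorem exists_mfderiv_eq_of_normalCov_eq_zero {V : Π x : M, TangentSpace J (φ x)}
    {v : TangentSpace I x} (h : normalCov I J φ V x v = 0) :
    ∃ w, mfderiv I J φ x w = pullbackCov I J φ V x v := by
  have h1 := (Submodule.starProjection_apply_eq_zero_iff _).1 h
  rw [normalSpace, Submodule.orthogonal_orthogonal] at h1
  exact h1

end SecondFundamentalForm

/-! ### Isometric immersions whose tension field is parallel in the normal bundle -/

section ParallelTension

variable {E : Type*} [NormedAddCommGroup E] [NormedSpace ℝ E] [FiniteDimensional ℝ E]
  {H : Type*} [TopologicalSpace H] {I : ModelWithCorners ℝ E H} [I.Boundaryless]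
  {M : Type*} [TopologicalSpace M] [ChartedSpace H M] [IsManifold I ∞ M]
  [RiemannianBundle (fun x : M ↦ TangentSpace I x)]
  [IsContMDiffRiemannianBundle I ∞ E (fun x : M ↦ TangentSpace I x)]
  {F : Type*} [NormedAddCommGroup F] [NormedSpace ℝ F] [FiniteDimensional ℝ F]
  {G : Type*} [TopologicalSpace G] {J : ModelWithCorners ℝ F G} [J.Boundaryless]
  {N : Type*} [TopologicalSpace N] [ChartedSpace G N] [IsManifold J ∞ N]
  [RiemannianBundle (fun y : N ↦ TangentSpace J y)]
  [IsContMDiffRiemannianBundle J ∞ F (fun y : N ↦ TangentSpace J y)]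
  {φ : M → N} {x : M} {X Y Z : Π x : M, TangentSpace I x}

/-- The Ricci identity. -/
theorem secondCov_sub_secondCov (hφ : ContMDiff I J ∞ φ) {V : Π x : M, TangentSpace J (φ x)}
    (hV : SmoothAlong I J φ V x) (hX : SmoothField I X x) (hY : SmoothField I Y x) :
    secondCov I J φ V X Y x - secondCov I J φ V Y X x
      = curvature J (φ x) (mfderiv I J φ x (X x)) (mfderiv I J φ x (Y x)) (V x) := by
  rw [← pullbackCurvature_eq_curvature hφ hX hY hV, secondCov, secondCov, pullbackCurvature,
    ← leviCivita_sub_eq_mlieBracket hX hY, map_sub]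
  abel

/-- The derivative of the function `⟨∇̄_Y V, dφ Z⟩` for a field `V` which is parallel in the normal
bundle. -/
theorem mvfderiv_inner_pullbackCov (hφ : IsIsometricImmersion I J φ)
    {V : Π x : M, TangentSpace J (φ x)} (hV : SmoothAlong I J φ V x)
    (hpar : ∀ z v, normalCov I J φ V z v = 0) (hY : SmoothField I Y x) (hZ : SmoothField I Z x) :
    mvfderiv I (fun z ↦ inner ℝ (pullbackCov I J φ V z (Y z)) (mfderiv I J φ z (Z z))) x (X x)
      = inner ℝ (secondCov I J φ V X Y x) (mfderiv I J φ x (Z x))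
        + inner ℝ (pullbackCov I J φ V x (leviCivita I Y x (X x))) (mfderiv I J φ x (Z x))
        + inner ℝ (pullbackCov I J φ V x (Y x)) (mfderiv I J φ x (leviCivita I Z x (X x))) := by
  have hs := hφ.contMDiff
  obtain ⟨w, hw⟩ := exists_mfderiv_eq_of_normalCov_eq_zero (hpar x (Y x))
  have h1 : inner ℝ (pullbackCov I J φ V x (Y x))
      (secondFundamentalForm I J φ x (X x) (Z x)) = (0 : ℝ) := by
    rw [← hw, real_inner_comm, inner_secondFundamentalForm_mfderiv hφ]
  rw [pullbackCov_metric hs (hV.pullbackCov hs hY) (hZ.mfderiv_along hs),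
    pullbackCov_mfderiv hs hZ, inner_add_right, h1, secondCov, inner_sub_left]
  ring

theorem inner_pullbackCov_mfderiv_symm (hφ : IsIsometricImmersion I J φ)
    {V : Π x : M, TangentSpace J (φ x)} (hV : SmoothAlong I J φ V x)
    (hn : ∀ z, V z ∈ normalSpace I J φ z) (u v : TangentSpace I x) :
    inner ℝ (pullbackCov I J φ V x u) (mfderiv I J φ x v)
      = (inner ℝ (pullbackCov I J φ V x v) (mfderiv I J φ x u) : ℝ) := by
  rw [inner_pullbackCov_mfderiv hφ hV hn, inner_pullbackCov_mfderiv hφ hV hn,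
    secondFundamentalForm_symm hφ.contMDiff]

/-- The derivative of the symmetry of `⟨∇̄_Y V, dφ Z⟩` in `Y` and `Z`. -/
theorem inner_secondCov_mfderiv_symm (hφ : IsIsometricImmersion I J φ)
    {V : Π x : M, TangentSpace J (φ x)} (hV : SmoothAlong I J φ V x)
    (hn : ∀ z, V z ∈ normalSpace I J φ z) (hpar : ∀ z v, normalCov I J φ V z v = 0)
    (hY : SmoothField I Y x) (hZ : SmoothField I Z x) :
    inner ℝ (secondCov I J φ V X Y x) (mfderiv I J φ x (Z x))
      = (inner ℝ (secondCov I J φ V X Z x) (mfderiv I J φ x (Y x)) : ℝ) := by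
  have h1 := mvfderiv_inner_pullbackCov hφ hV hpar (X := X) hY hZ
  have h2 := mvfderiv_inner_pullbackCov hφ hV hpar (X := X) hZ hY
  have h3 : (fun z ↦ (inner ℝ (pullbackCov I J φ V z (Y z)) (mfderiv I J φ z (Z z)) : ℝ))
      =ᶠ[𝓝 x] fun z ↦ inner ℝ (pullbackCov I J φ V z (Z z)) (mfderiv I J φ z (Y z)) :=
    hV.eventually.mono fun z hz ↦ inner_pullbackCov_mfderiv_symm hφ hz hn _ _
  rw [mvfderiv_congr h3, h2, inner_pullbackCov_mfderiv_symm hφ hV hn (Z x),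
    inner_pullbackCov_mfderiv_symm hφ hV hn _ (Y x)] at h1
  linarith

theorem inner_pullbackCov_tension_self (hφ : IsIsometricImmersion I J φ)
    (hpar : ∀ z v, normalCov I J φ (tension I J φ) z v = 0) (v : TangentSpace I x) :
    inner ℝ (pullbackCov I J φ (tension I J φ) x v) (tension I J φ x) = (0 : ℝ) := by
  obtain ⟨w, hw⟩ := exists_mfderiv_eq_of_normalCov_eq_zero (hpar x v)
  rw [← hw, real_inner_comm, inner_mfderiv_of_mem_normalSpace (tension_mem_normalSpace hφ)]

theorem mvfderiv_inner_tension_self (hφ : IsIsometricImmersion I J φ)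
    (hpar : ∀ z v, normalCov I J φ (tension I J φ) z v = 0) (v : TangentSpace I x) :
    mvfderiv I (fun z ↦ inner ℝ (tension I J φ z) (tension I J φ z)) x v = (0 : ℝ) := by
  have hτ := smoothAlong_tension (x := x) hφ.contMDiff
  rw [pullbackCov_metric hφ.contMDiff hτ hτ,
    real_inner_comm (pullbackCov I J φ (tension I J φ) x v) (tension I J φ x),
    inner_pullbackCov_tension_self hφ hpar, add_zero]

/-- The trace of `⟨∇̄τ, dφ⟩` is the function `-‖τ‖²`, which is locally constant; so the trace of its
derivative vanishes. -/
theorem sum_inner_secondCov_tension (hφ : IsIsometricImmersion I J φ)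
    (hpar : ∀ z v, normalCov I J φ (tension I J φ) z v = 0)
    (Z : Π x : M, TangentSpace I x) {k : ℕ} (e : OrthonormalBasis (Fin k) ℝ (TangentSpace I x)) :
    ∑ i, inner ℝ (secondCov I J φ (tension I J φ) Z (extend E (e i)) x)
      (mfderiv I J φ x (e i)) = (0 : ℝ) := by
  have hs := hφ.contMDiff
  have hτ := smoothAlong_tension (x := x) hs
  have hn (z : M) : tension I J φ z ∈ normalSpace I J φ z := tension_mem_normalSpace hφ
  obtain ⟨f, hf, hfe, hb⟩ := exists_orthonormalFrame e
  let a (u v : TangentSpace I x) : ℝ :=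
    inner ℝ (pullbackCov I J φ (tension I J φ) x u) (mfderiv I J φ x v)
  have ha (u v) : a u v = a v u := inner_pullbackCov_mfderiv_symm hφ hτ hn u v
  let c (i j : Fin k) : ℝ := inner ℝ (e j) (leviCivita I (f i) x (Z x))
  -- the connection form of an orthonormal frame is skew-symmetric
  have hc (i j) : c i j = -c j i := by
    have h1 : (fun z ↦ (inner ℝ (f i z) (f j z) : ℝ)) =ᶠ[𝓝 x]
        fun _ ↦ if i = j then (1 : ℝ) else 0 := by
      filter_upwards [hb] with z ⟨b, hb⟩
      rw [← hb, ← hb, orthonormal_iff_ite.1 b.orthonormal i j]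
    have h2 := leviCivita_metric I (hf i).mdifferentiableAt (hf j).mdifferentiableAt (Z x)
    rw [mvfderiv_congr h1, mvfderiv_const, zero_apply, hfe, hfe, real_inner_comm] at h2
    exact eq_neg_of_add_eq_zero_left h2.symm
  have h1 (i) : a (e i) (leviCivita I (f i) x (Z x)) = ∑ j, c i j * a (e i) (e j) := by
    conv_lhs => rw [← e.sum_repr' (leviCivita I (f i) x (Z x))]
    simp only [a, map_sum, map_smul, inner_sum, real_inner_smul_right, c]
  have h2 : ∑ i, a (e i) (leviCivita I (f i) x (Z x)) = 0 := by
    have h3 : ∑ i, ∑ j, c i j * a (e i) (e j) = -∑ i, ∑ j, c i j * a (e i) (e j) := by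
      conv_lhs => rw [Finset.sum_comm]
      simp only [← Finset.sum_neg_distrib]
      refine Finset.sum_congr rfl fun i _ ↦ Finset.sum_congr rfl fun j _ ↦ ?_
      rw [hc, ha, neg_mul]
    simp only [h1]
    linarith
  have h3 : (fun z ↦ ∑ i, (inner ℝ (pullbackCov I J φ (tension I J φ) z (f i z))
      (mfderiv I J φ z (f i z)) : ℝ)) =ᶠ[𝓝 x]
      fun z ↦ (-1 : ℝ) * inner ℝ (tension I J φ z) (tension I J φ z) := by
    filter_upwards [hb, hτ.eventually] with z ⟨b, hb⟩ hz
    simp only [← hb, inner_pullbackCov_mfderiv hφ hz hn, Finset.sum_neg_distrib, ← inner_sum]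
    rw [← tension_eq_sum hs b, neg_one_mul]
  have h4 (i) : SmoothNear I 𝓘(ℝ) (fun z ↦ (inner ℝ (pullbackCov I J φ (tension I J φ) z (f i z))
      (mfderiv I J φ z (f i z)) : ℝ)) x :=
    (hτ.pullbackCov hs (hf i)).inner ((hf i).mfderiv_along hs)
  have h5 : mvfderiv I (fun z ↦ ∑ i, (inner ℝ (pullbackCov I J φ (tension I J φ) z (f i z))
      (mfderiv I J φ z (f i z)) : ℝ)) x (Z x)
      = ∑ i, mvfderiv I (fun z ↦ (inner ℝ (pullbackCov I J φ (tension I J φ) z (f i z))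
      (mfderiv I J φ z (f i z)) : ℝ)) x (Z x) :=
    mvfderiv_fun_sum_apply (fun i _ ↦ (h4 i).mdifferentiableAt) (Z x)
  have h6 : mvfderiv I (fun z ↦ (-1 : ℝ) * inner ℝ (tension I J φ z) (tension I J φ z)) x (Z x)
      = 0 := by
    rw [mvfderiv_fun_mul mdifferentiableAt_const (hτ.inner hτ).mdifferentiableAt, mvfderiv_const,
      smul_zero, add_zero, smul_apply, mvfderiv_inner_tension_self hφ hpar, smul_zero]
  rw [mvfderiv_congr h3, h6] at h5
  have h7 (i) : mvfderiv I (fun z ↦ (inner ℝ (pullbackCov I J φ (tension I J φ) z (f i z))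
      (mfderiv I J φ z (f i z)) : ℝ)) x (Z x)
      = inner ℝ (secondCov I J φ (tension I J φ) Z (extend E (e i)) x) (mfderiv I J φ x (e i))
        + 2 * a (e i) (leviCivita I (f i) x (Z x)) := by
    have h8 := inner_secondCov_mfderiv_symm hφ hτ hn hpar (X := Z) (hf i) (smoothField_extend (e i))
    rw [extend_apply_self, hfe] at h8
    rw [mvfderiv_inner_pullbackCov hφ hτ hpar (X := Z) (hf i) (hf i), hfe, h8,
      inner_pullbackCov_mfderiv_symm hφ hτ hn]
    simp only [a]
    ring
  simp only [h7, Finset.sum_add_distrib, ← Finset.mul_sum, h2] at h5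
  linarith

/-- The tangential part of `∑ ∇̄²_{e i, e i} τ`. -/
theorem inner_sum_secondCov_tension_mfderiv (hφ : IsIsometricImmersion I J φ)
    (hpar : ∀ z v, normalCov I J φ (tension I J φ) z v = 0) (v : TangentSpace I x) {k : ℕ}
    (e : OrthonormalBasis (Fin k) ℝ (TangentSpace I x)) :
    inner ℝ (∑ i, secondCov I J φ (tension I J φ) (extend E (e i)) (extend E (e i)) x)
      (mfderiv I J φ x v)
      = (inner ℝ (∑ i, curvature J (φ x) (tension I J φ x) (mfderiv I J φ x (e i))
        (mfderiv I J φ x (e i))) (mfderiv I J φ x v) : ℝ) := by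
  have hs := hφ.contMDiff
  have hτ := smoothAlong_tension (x := x) hs
  have hn (z : M) : tension I J φ z ∈ normalSpace I J φ z := tension_mem_normalSpace hφ
  have hv := smoothField_extend v
  rw [sum_inner, sum_inner, ← sub_eq_zero, ← sum_inner_secondCov_tension hφ hpar (extend E v) e,
    ← Finset.sum_sub_distrib]
  refine Finset.sum_congr rfl fun i _ ↦ ?_
  have he := smoothField_extend (e i)
  have h1 := inner_secondCov_mfderiv_symm hφ hτ hn hpar (X := extend E (e i)) he hv
  have h2 := secondCov_sub_secondCov hs hτ he hv
  have h3 := inner_curvature_pair_symm (J := J) (φ x) (mfderiv I J φ x (e i)) (mfderiv I J φ x v)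
    (tension I J φ x) (mfderiv I J φ x (e i))
  simp only [extend_apply_self] at h1 h2
  rw [h1, ← h3, ← h2, inner_sub_left]
  ring

theorem inner_secondCov_tension_self (hφ : IsIsometricImmersion I J φ)
    (hpar : ∀ z v, normalCov I J φ (tension I J φ) z v = 0) (v : TangentSpace I x) :
    inner ℝ (secondCov I J φ (tension I J φ) (extend E v) (extend E v) x) (tension I J φ x)
      = -‖pullbackCov I J φ (tension I J φ) x v‖ ^ 2 := by
  have hs := hφ.contMDiff
  have hτ := smoothAlong_tension (x := x) hs
  have hv := smoothField_extend v
  have h1 : (fun z ↦ (inner ℝ (pullbackCov I J φ (tension I J φ) z (extend E v z))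
      (tension I J φ z) : ℝ)) = fun _ ↦ 0 :=
    funext fun z ↦ inner_pullbackCov_tension_self hφ hpar _
  have h2 := pullbackCov_metric hs (hτ.pullbackCov hs hv) hτ v
  rw [h1, mvfderiv_const, zero_apply, extend_apply_self, real_inner_self_eq_norm_sq] at h2
  rw [secondCov, inner_sub_left, inner_pullbackCov_tension_self hφ hpar, extend_apply_self]
  linarith

/-- Since `∇̄_v τ` is tangential, it is given by the shape operator. -/
theorem norm_pullbackCov_tension_sq (hφ : IsIsometricImmersion I J φ)
    (hpar : ∀ z v, normalCov I J φ (tension I J φ) z v = 0) (v : TangentSpace I x) {k : ℕ}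
    (e : OrthonormalBasis (Fin k) ℝ (TangentSpace I x)) :
    ‖pullbackCov I J φ (tension I J φ) x v‖ ^ 2
      = ∑ j, inner ℝ (tension I J φ x) (secondFundamentalForm I J φ x v (e j)) ^ 2 := by
  have hτ := smoothAlong_tension (x := x) hφ.contMDiff
  have hn (z : M) : tension I J φ z ∈ normalSpace I J φ z := tension_mem_normalSpace hφ
  obtain ⟨w, hw⟩ := exists_mfderiv_eq_of_normalCov_eq_zero (hpar x v)
  have h1 : ‖pullbackCov I J φ (tension I J φ) x v‖ ^ 2 = ‖w‖ ^ 2 := by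
    rw [← hw, ← real_inner_self_eq_norm_sq, ← real_inner_self_eq_norm_sq, hφ.inner_mfderiv]
  rw [h1, ← e.sum_sq_norm_inner_right w]
  refine Finset.sum_congr rfl fun j _ ↦ ?_
  rw [← hφ.inner_mfderiv, hw, real_inner_comm, inner_pullbackCov_mfderiv hφ hτ hn, norm_neg,
    Real.norm_eq_abs, sq_abs]

/-- The tangential part of the bitension field. -/
theorem inner_bitension_mfderiv (hφ : IsIsometricImmersion I J φ)
    (hpar : ∀ z v, normalCov I J φ (tension I J φ) z v = 0) (v : TangentSpace I x) :
    inner ℝ (bitension I J φ x) (mfderiv I J φ x v)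
      = (-2 * inner ℝ (curvatureTrace I J φ (tension I J φ) x) (mfderiv I J φ x v) : ℝ) := by
  have h := inner_sum_secondCov_tension_mfderiv hφ hpar v
    (stdOrthonormalBasis ℝ (TangentSpace I x))
  rw [bitension, inner_sub_left, roughLaplacian, inner_neg_left, h, curvatureTrace]
  ring

/-- The component of the bitension field in the direction of the tension field. -/
theorem inner_bitension_tension (hφ : IsIsometricImmersion I J φ)
    (hpar : ∀ z v, normalCov I J φ (tension I J φ) z v = 0) :
    inner ℝ (bitension I J φ x) (tension I J φ x)
      = (∑ i, ∑ j, inner ℝ (tension I J φ x) (secondFundamentalForm I J φ x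
          (stdOrthonormalBasis ℝ (TangentSpace I x) i)
          (stdOrthonormalBasis ℝ (TangentSpace I x) j)) ^ 2
        - inner ℝ (curvatureTrace I J φ (tension I J φ) x) (tension I J φ x) : ℝ) := by
  rw [bitension, inner_sub_left, roughLaplacian, inner_neg_left, sum_inner]
  simp only [inner_secondCov_tension_self hφ hpar,
    norm_pullbackCov_tension_sq hφ hpar _ (stdOrthonormalBasis ℝ (TangentSpace I x))]
  rw [Finset.sum_neg_distrib, neg_neg]

end ParallelTension

/-! ### Hypersurfaces -/

section Constancy

variable {E : Type*} [NormedAddCommGroup E] [NormedSpace ℝ E]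
  {H : Type*} [TopologicalSpace H] {I : ModelWithCorners ℝ E H} [I.Boundaryless]
  {M : Type*} [TopologicalSpace M] [ChartedSpace H M] [IsManifold I ∞ M]

theorem isLocallyConstant_of_mfderiv_eq_zero {f : M → ℝ} (hf : MDifferentiable I 𝓘(ℝ) f)
    (h : ∀ x, mfderiv I 𝓘(ℝ) f x = 0) : IsLocallyConstant f := by
  rw [IsLocallyConstant.iff_eventually_eq]
  intro x
  let χ := extChartAt I x
  let g : E → ℝ := f ∘ χ.symm
  have hopen : IsOpen χ.target := isOpen_extChartAt_target x
  have h1 (p : E) (hp : p ∈ χ.target) : HasFDerivAt g (0 : E →L[ℝ] ℝ) p := by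
    have h2 : MDifferentiableAt 𝓘(ℝ, E) I χ.symm p :=
      ((contMDiffOn_extChartAt_symm (I := I) (n := ∞) x).contMDiffAt
        (hopen.mem_nhds hp)).mdifferentiableAt (by simp)
    have h3 := (hf (χ.symm p)).hasMFDerivAt.comp p h2.hasMFDerivAt
    rw [h] at h3
    have h4 := h3.hasFDerivAt
    exact h4
  have h2 : IsOpen (χ.target ∩ g ⁻¹' {f x}) :=
    hopen.isOpen_inter_preimage_of_fderiv_eq_zero
      (fun p hp ↦ (h1 p hp).differentiableAt.differentiableWithinAt) (fun p hp ↦ (h1 p hp).fderiv) _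
  have h3 : χ x ∈ χ.target ∩ g ⁻¹' {f x} :=
    ⟨mem_extChartAt_target x, congrArg f (extChartAt_to_inv x)⟩
  filter_upwards [(continuousAt_extChartAt (I := I) x).eventually (h2.mem_nhds h3),
    extChartAt_source_mem_nhds (I := I) x] with z h4 h5
  exact (congrArg f (χ.left_inv h5)).symm.trans h4.2

end Constancy

section Hypersurface

variable {E : Type*} [NormedAddCommGroup E] [NormedSpace ℝ E] [FiniteDimensional ℝ E]
  {H : Type*} [TopologicalSpace H] {I : ModelWithCorners ℝ E H} [I.Boundaryless]
  {M : Type*} [TopologicalSpace M] [ChartedSpace H M] [IsManifold I ∞ M]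
  [RiemannianBundle (fun x : M ↦ TangentSpace I x)]
  [IsContMDiffRiemannianBundle I ∞ E (fun x : M ↦ TangentSpace I x)]
  {F : Type*} [NormedAddCommGroup F] [NormedSpace ℝ F] [FiniteDimensional ℝ F]
  {G : Type*} [TopologicalSpace G] {J : ModelWithCorners ℝ F G} [J.Boundaryless]
  {N : Type*} [TopologicalSpace N] [ChartedSpace G N] [IsManifold J ∞ N]
  [RiemannianBundle (fun y : N ↦ TangentSpace J y)]
  [IsContMDiffRiemannianBundle J ∞ F (fun y : N ↦ TangentSpace J y)]
  {φ : M → N} {x : M}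

/-- The norm of the tension field is constant. -/
theorem tension_ne_zero [ConnectedSpace M] (hφ : IsIsometricImmersion I J φ)
    (hpar : ∀ z v, normalCov I J φ (tension I J φ) z v = 0) (hnh : ¬ IsHarmonic I J φ) (x : M) :
    tension I J φ x ≠ 0 := by
  have hτ (z : M) := smoothAlong_tension (x := z) hφ.contMDiff
  have h1 : IsLocallyConstant fun z ↦ (inner ℝ (tension I J φ z) (tension I J φ z) : ℝ) :=
    isLocallyConstant_of_mfderiv_eq_zero
      (fun z ↦ ((hτ z).inner (hτ z)).mdifferentiableAt)
      fun z ↦ ContinuousLinearMap.ext fun v ↦ mvfderiv_inner_tension_self hφ hpar v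
  intro hx
  refine hnh fun z ↦ ?_
  have h2 := h1.apply_eq_of_preconnectedSpace z x
  rw [hx, inner_zero_left] at h2
  exact inner_self_eq_zero.1 h2

/-- For a hypersurface, an orthonormal basis of the tangent space of `M` and a unit normal vector
form an orthonormal basis of the tangent space of `N`. -/
theorem exists_orthonormalBasis_normal (hφ : IsIsometricImmersion I J φ)
    (hEF : finrank ℝ E + 1 = finrank ℝ F) {k : ℕ}
    (e : OrthonormalBasis (Fin k) ℝ (TangentSpace I x)) {ν : TangentSpace J (φ x)}
    (hν : ν ∈ normalSpace I J φ x) (hν1 : ‖ν‖ = 1) :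
    ∃ b : OrthonormalBasis (Option (Fin k)) ℝ (TangentSpace J (φ x)),
      b none = ν ∧ ∀ i, b (some i) = mfderiv I J φ x (e i) := by
  let v (i : Option (Fin k)) : TangentSpace J (φ x) :=
    i.elim ν fun i ↦ mfderiv I J φ x (e i)
  have hv : Orthonormal ℝ v := by
    rw [orthonormal_iff_ite]
    rintro (_ | i) (_ | j)
    · simp [v, hν1]
    · simp [v, inner_mfderiv_of_mem_normalSpace hν]
    · simp only [v, Option.elim]
      rw [real_inner_comm, inner_mfderiv_of_mem_normalSpace hν]
      simp
    · simp only [v, Option.elim, hφ.inner_mfderiv, Option.some.injEq]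
      exact orthonormal_iff_ite.1 e.orthonormal i j
  have hcard : Fintype.card (Option (Fin k)) = finrank ℝ (TangentSpace J (φ x)) := by
    have h1 : finrank ℝ E = Fintype.card (Fin k) := finrank_eq_card_basis e.toBasis
    rw [Fintype.card_option, ← h1]
    exact hEF
  refine ⟨OrthonormalBasis.mk hv (hv.linearIndependent.span_eq_top_of_card_eq_finrank' hcard).ge,
    ?_, fun i ↦ ?_⟩ <;> rw [OrthonormalBasis.coe_mk] <;> rfl

/-- For a hypersurface, a vector which is orthogonal to the tangent space of `M` and to a unit
normal vector vanishes. -/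
theorem eq_zero_of_inner_mfderiv_eq_zero (hφ : IsIsometricImmersion I J φ)
    (hEF : finrank ℝ E + 1 = finrank ℝ F) {ν : TangentSpace J (φ x)}
    (hν : ν ∈ normalSpace I J φ x) (hν1 : ‖ν‖ = 1) {w : TangentSpace J (φ x)}
    (h1 : ∀ v, inner ℝ w (mfderiv I J φ x v) = (0 : ℝ)) (h2 : inner ℝ w ν = (0 : ℝ)) : w = 0 := by
  obtain ⟨b, hb, hb'⟩ := exists_orthonormalBasis_normal hφ hEF
    (stdOrthonormalBasis ℝ (TangentSpace I x)) hν hν1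
  rw [← b.sum_repr' w, Fintype.sum_option, hb, real_inner_comm, h2, zero_smul, zero_add]
  refine Finset.sum_eq_zero fun i _ ↦ ?_
  rw [hb', real_inner_comm, h1, zero_smul]

/-- The normal space of a hypersurface is a line. -/
theorem eq_inner_smul_of_mem_normalSpace (hφ : IsIsometricImmersion I J φ)
    (hEF : finrank ℝ E + 1 = finrank ℝ F) {ν : TangentSpace J (φ x)}
    (hν : ν ∈ normalSpace I J φ x) (hν1 : ‖ν‖ = 1) {n : TangentSpace J (φ x)}
    (hn : n ∈ normalSpace I J φ x) : n = (inner ℝ n ν : ℝ) • ν := by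
  rw [← sub_eq_zero]
  refine eq_zero_of_inner_mfderiv_eq_zero hφ hEF hν hν1 (fun v ↦ ?_) ?_
  · rw [inner_sub_left, real_inner_smul_left, inner_mfderiv_of_mem_normalSpace hν,
      inner_mfderiv_of_mem_normalSpace hn, mul_zero, sub_zero]
  · rw [inner_sub_left, real_inner_smul_left, real_inner_self_eq_norm_sq, hν1]
    ring

theorem ricciTransform_eq_sum {y : N} {ι : Type*} [Fintype ι]
    (b : OrthonormalBasis ι ℝ (TangentSpace J y)) (u : TangentSpace J y) :
    ricciTransform J y u = ∑ i, curvature J y u (b i) (b i) :=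
  sum_orthonormalBasis_eq (curvatureHom J y u) (stdOrthonormalBasis ℝ (TangentSpace J y)) b

theorem ricciTransform_smul {y : N} (c : ℝ) (u : TangentSpace J y) :
    ricciTransform J y (c • u) = c • ricciTransform J y u := by
  rw [ricciTransform, ricciTransform, Finset.smul_sum]
  exact Finset.sum_congr rfl fun i _ ↦ curvature_smul_left y u _ _ c

/-- For a hypersurface and a normal field, the trace of the curvature over the tangent space of `M`
is the Ricci transform: the missing term is `R(ν, ν)ν = 0`. -/
theorem curvatureTrace_eq_ricciTransform (hφ : IsIsometricImmersion I J φ)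
    (hEF : finrank ℝ E + 1 = finrank ℝ F) {ν : TangentSpace J (φ x)}
    (hν : ν ∈ normalSpace I J φ x) (hν1 : ‖ν‖ = 1) {V : Π x : M, TangentSpace J (φ x)}
    (hV : V x ∈ normalSpace I J φ x) :
    curvatureTrace I J φ V x = ricciTransform J (φ x) (V x) := by
  obtain ⟨b, hb, hb'⟩ := exists_orthonormalBasis_normal hφ hEF
    (stdOrthonormalBasis ℝ (TangentSpace I x)) hν hν1
  have h1 : curvature J (φ x) (V x) ν ν = 0 := by
    rw [eq_inner_smul_of_mem_normalSpace hφ hEF hν hν1 hV, curvature_smul_left, curvature_self,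
      smul_zero]
  rw [ricciTransform_eq_sum b, Fintype.sum_option, hb, h1, zero_add]
  simp only [hb']
  rfl

/-- If `τ = a ν` at `x`, then the tangential part of the bitension field is `-2a ρ(ν)ᵀ` and its
normal component is `a (‖B‖² - ⟨ρ(ν), ν⟩)`. -/
theorem bitension_eq_zero_iff (hφ : IsIsometricImmersion I J φ)
    (hEF : finrank ℝ E + 1 = finrank ℝ F)
    (hpar : ∀ z v, normalCov I J φ (tension I J φ) z v = 0) (hτ : tension I J φ x ≠ 0)
    {ν : TangentSpace J (φ x)} (hν : ν ∈ normalSpace I J φ x) (hν1 : ‖ν‖ = 1) :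
    bitension I J φ x = 0 ↔
      ricciTransform J (φ x) ν = secondFundamentalFormNormSq I J φ x • ν := by
  have hn := tension_mem_normalSpace (x := x) hφ
  obtain ⟨a, ha⟩ : ∃ a : ℝ, tension I J φ x = a • ν :=
    ⟨_, eq_inner_smul_of_mem_normalSpace hφ hEF hν hν1 hn⟩
  have ha0 : a ≠ 0 := by
    rintro rfl
    exact hτ (by rw [ha, zero_smul])
  have hνν : inner ℝ ν ν = (1 : ℝ) := by rw [real_inner_self_eq_norm_sq, hν1, one_pow]
  have hB (u v : TangentSpace I x) :
      inner ℝ (tension I J φ x) (secondFundamentalForm I J φ x u v) ^ 2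
        = a ^ 2 * ‖secondFundamentalForm I J φ x u v‖ ^ 2 := by
    obtain ⟨c, hc⟩ : ∃ c : ℝ, secondFundamentalForm I J φ x u v = c • ν :=
      ⟨_, eq_inner_smul_of_mem_normalSpace hφ hEF hν hν1
        (secondFundamentalForm_mem_normalSpace hφ u v)⟩
    rw [hc, ha, real_inner_smul_left, real_inner_smul_right, hνν, norm_smul, hν1,
      Real.norm_eq_abs, mul_one, mul_one, sq_abs, mul_pow]
  have hR := curvatureTrace_eq_ricciTransform hφ hEF hν hν1 hn
  rw [ha, ricciTransform_smul] at hR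
  have htan (v : TangentSpace I x) : inner ℝ (bitension I J φ x) (mfderiv I J φ x v)
      = -2 * a * inner ℝ (ricciTransform J (φ x) ν) (mfderiv I J φ x v) := by
    rw [inner_bitension_mfderiv hφ hpar, hR, real_inner_smul_left]
    ring
  have hnor : inner ℝ (bitension I J φ x) ν
      = a * (secondFundamentalFormNormSq I J φ x - inner ℝ (ricciTransform J (φ x) ν) ν) := by
    have h1 := inner_bitension_tension (x := x) hφ hpar
    simp only [hB, ← Finset.mul_sum] at h1
    rw [hR, ha, real_inner_smul_right, real_inner_smul_right, real_inner_smul_left] at h1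
    refine mul_left_cancel₀ ha0 (h1.trans ?_)
    rw [secondFundamentalFormNormSq]
    ring
  constructor
  · intro h
    rw [← sub_eq_zero]
    refine eq_zero_of_inner_mfderiv_eq_zero hφ hEF hν hν1 (fun v ↦ ?_) ?_
    · have h1 := htan v
      rw [h, inner_zero_left] at h1
      rw [inner_sub_left, real_inner_smul_left, inner_mfderiv_of_mem_normalSpace hν, mul_zero,
        sub_zero]
      exact (mul_eq_zero.1 h1.symm).resolve_left (by simpa using ha0)
    · rw [h, inner_zero_left] at hnor
      have h1 := (mul_eq_zero.1 hnor.symm).resolve_left ha0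
      rw [inner_sub_left, real_inner_smul_left, hνν]
      linarith
  · intro h
    refine eq_zero_of_inner_mfderiv_eq_zero hφ hEF hν hν1 (fun v ↦ ?_) ?_
    · rw [htan, h, real_inner_smul_left, inner_mfderiv_of_mem_normalSpace hν]
      ring
    · rw [hnor, h, real_inner_smul_left, hνν]
      ring

theorem exists_isUnitNormal (hφ : IsIsometricImmersion I J φ)
    (hτ : ∀ x, tension I J φ x ≠ 0) :
    ∃ ξ : Π x : M, TangentSpace J (φ x), IsUnitNormal I J φ ξ := by
  refine ⟨fun x ↦ ‖tension I J φ x‖⁻¹ • tension I J φ x, fun x ↦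
    ⟨Submodule.smul_mem _ _ (tension_mem_normalSpace hφ), ?_⟩⟩
  rw [norm_smul, norm_inv, norm_norm, inv_mul_cancel₀ (norm_ne_zero_iff.2 (hτ x))]

end Hypersurface

end RiemGeom

end

theorem theorem3p6 {m n : ℕ} (hmn : m + 1 = n)
    {M : Type*} [TopologicalSpace M] [ChartedSpace (EuclideanSpace ℝ (Fin m)) M]
    [IsManifold (𝓡 m) ∞ M] [ConnectedSpace M]
    [RiemannianBundle (fun x : M ↦ TangentSpace (𝓡 m) x)]
    [IsContMDiffRiemannianBundle (𝓡 m) ∞ (EuclideanSpace ℝ (Fin m))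
      (fun x : M ↦ TangentSpace (𝓡 m) x)]
    {N : Type*} [TopologicalSpace N] [ChartedSpace (EuclideanSpace ℝ (Fin n)) N]
    [IsManifold (𝓡 n) ∞ N]
    [RiemannianBundle (fun y : N ↦ TangentSpace (𝓡 n) y)]
    [IsContMDiffRiemannianBundle (𝓡 n) ∞ (EuclideanSpace ℝ (Fin n))
      (fun y : N ↦ TangentSpace (𝓡 n) y)]
    (φ : M → N) (hφ : RiemGeom.IsIsometricImmersion (𝓡 m) (𝓡 n) φ)
    (hpar : ∀ (x : M) (v : TangentSpace (𝓡 m) x),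
      RiemGeom.normalCov (𝓡 m) (𝓡 n) φ (RiemGeom.tension (𝓡 m) (𝓡 n) φ) x v = 0)
    (hnh : ¬ RiemGeom.IsHarmonic (𝓡 m) (𝓡 n) φ) :
    (∀ ξ : Π x : M, TangentSpace (𝓡 n) (φ x), RiemGeom.IsUnitNormal (𝓡 m) (𝓡 n) φ ξ →
      (RiemGeom.IsBiharmonic (𝓡 m) (𝓡 n) φ ↔
        ∀ x, RiemGeom.ricciTransform (𝓡 n) (φ x) (ξ x)
          = RiemGeom.secondFundamentalFormNormSq (𝓡 m) (𝓡 n) φ x • ξ x)) ∧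
    (∀ c : ℝ, RiemGeom.IsEinstein (𝓡 n) N c →
      (RiemGeom.IsBiharmonic (𝓡 m) (𝓡 n) φ ↔
        ∀ x, RiemGeom.secondFundamentalFormNormSq (𝓡 m) (𝓡 n) φ x = c)) := by
  have hdim : finrank ℝ (EuclideanSpace ℝ (Fin m)) + 1 = finrank ℝ (EuclideanSpace ℝ (Fin n)) := by
    rw [finrank_euclideanSpace_fin, finrank_euclideanSpace_fin, hmn]
  have hτ := RiemGeom.tension_ne_zero hφ hpar hnh
  have key (ξ : Π x : M, TangentSpace (𝓡 n) (φ x)) (hξ : RiemGeom.IsUnitNormal (𝓡 m) (𝓡 n) φ ξ) :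
      RiemGeom.IsBiharmonic (𝓡 m) (𝓡 n) φ ↔
        ∀ x, RiemGeom.ricciTransform (𝓡 n) (φ x) (ξ x)
          = RiemGeom.secondFundamentalFormNormSq (𝓡 m) (𝓡 n) φ x • ξ x :=
    forall_congr' fun x ↦
      RiemGeom.bitension_eq_zero_iff hφ hdim hpar (hτ x) (hξ x).1 (hξ x).2
  refine ⟨key, fun c hc ↦ ?_⟩
  obtain ⟨ξ, hξ⟩ := RiemGeom.exists_isUnitNormal hφ hτ
  refine (key ξ hξ).trans (forall_congr' fun x ↦ ?_)
  have hx : ξ x ≠ 0 := fun h ↦ by simpa [h] using (hξ x).2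
  rw [hc (φ x) (ξ x)]
  exact (smul_left_injective ℝ hx).eq_iff.trans eq_comm
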